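/- **Setting.** Let $k,n\in\mathbb N$. The outcome is $y=x^T\beta+\epsilon$ with $x\sim N(0,I_k)$, $\epsilon\sim N(0,\sigma^2)$ and $\beta\in\mathbb R^k$ with i.i.d. entries drawn from a distribution $F_\beta$ with finite second moment $\bar\beta^2=\mathbb E[\beta_l^2]$. Each of two firms $i=1,2$ has an independent dataset $(X_i,Y_i)$ of $n$ i.i.d. data points, $Y_i=X_i\beta+\eta_i$, with covariates and noise distributed like $x$ and $\epsilon$; everything is independent given $\beta$, and $\beta$ is independent of $x$, $\epsilon$, $X_i$, $\eta_i$. A model is a subset $M\subseteq\{1,\dots,k\}$; a firm $i$ with model $M$ predicts $x^T\hat\beta^{(i)}$, where $\hat\beta^{(i)}_M=(X_{i,M}^TX_{i,M})^{-1}X_{i,M}^TY_i$ and $\hat\beta^{(i)}_l=0$ for $l\notin M$. **1. Prediction error.** If $|M|+1<n$, then $\hat\beta^{(i)}$ is integrable given $\beta$, and the following three expectations are finite: $$B=\mathbb E\big[(x^T\beta-x^T\mathbb E[\hat\beta^{(i)}\mid\beta])^2\big]=\bar\beta^2(k-|M|),$$ $$V=\mathbb E\big[(x^T\mathbb E[\hat\beta^{(i)}\mid\beta]-x^T\hat\beta^{(i)})^2\big]=(\bar\beta^2(k-|M|)+\sigma^2)\frac{|M|}{n-|M|-1},$$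 $$\mathbb E[(y-x^T\hat\beta^{(i)})^2]=\sigma^2+B+V .$$ **The game.** Let $k+1<n$. First each firm simultaneously stays out (payoff $0$) or enters with a model $M$ at cost $c(|M|)>0$. Then model choices are observed and the entrants simultaneously set prices $p_i$. Then the consumer observes models and prices, buys from a set $P$ of entrants, and predicts by $\sum_{i\in P}w_i\,x^T\hat\beta^{(i)}$ with weights $w_i\ge0$, $\sum_{i\in P}w_i=1$. Her payoff is minus the mean squared prediction error (or $\underline u<0$ if $P=\emptyset$) minus $\sum_{i\in P}p_i$. An entrant's profit is $p_i\mathbf 1\{i\in P\}-c(|M_i|)$. Equilibrium means pure-strategy subgame perfect Nash equilibrium. Let $U(E)$ be the consumer's payoff, gross of prices, from buying from $E$ with optimal weights, $U(\emptyset)=\underline u$. It is assumed throughout parts 2 and 3 that models have decreasing marginal returns: for every profile of model choices, all sets $E'\subseteq E$ of entrants and $j\in E'$, $U(E')-U(E'\setminus\{j\})\ge U(E)-U(E\setminus\{j\})$. **2. Costly covariates.** Let $c:\{0,1,2,\dots\}\to\mathbb R$ be positive, strictly increasing and convex, and let $\underline u<0$. There is $K$, depending only on $c$ and $\underline u$,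 such that whenever $k\ge K$ (for every $n>k+1$, $F_\beta$ and $\sigma^2\ge0$), there is no equilibrium in which both firms enter with the same covariate subset. **3. Costless covariates.** Let $\nu\ge1$ and $\frac{(\nu-1)(2\nu-1)}{\nu}<\rho<2\nu-1$. There are $\delta,\gamma>0$ and $K$, depending only on $\nu$ and $\rho$, such that whenever $k\ge K$, $n>k+1$, $|n/k-\nu|<\delta$, $\bar\beta^2>0$, $\big|\frac{\sigma^2}{\bar\beta^2k}-\rho\big|<\delta$, and entry with any model has the same cost $c>0$: there is no equilibrium in which both firms enter with the same covariate subset; and if moreover $c<\gamma\,\bar\beta^2k$, then there is an equilibrium in which both firms enter and use different covariate subsets. -/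

import Mathlib

open MeasureTheory ProbabilityTheory
open scoped NNReal Matrix

noncomputable section

namespace OLSMarket

/-! ### The statistical environment -/

/-- The exogenous part of one dataset: the `n × k` matrix of covariates and the `n` noise terms. -/
abbrev Draw (k n : ℕ) : Type := (Fin n → Fin k → ℝ) × (Fin n → ℝ)

/-- Law of one dataset draw: independent rows `x_j ∼ N(0, I_k)` and independent noise
terms `ε_j ∼ N(0, v)`, where `v = σ²`. -/
def drawLaw (k n : ℕ) (v : ℝ≥0) : Measure (Draw k n) :=
  (Measure.pi fun _ : Fin n => Measure.pi fun _ : Fin k => gaussianReal 0 1).prod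
    (Measure.pi fun _ : Fin n => gaussianReal 0 v)

/-- All primitive randomness: the coefficients `β`, the consumer's covariates `x` and noise `ε`,
and one dataset draw for each of the two firms. -/
abbrev Sample (k n : ℕ) : Type :=
  (Fin k → ℝ) × ((Fin k → ℝ) × ℝ) × (Fin 2 → Draw k n)

/-- Joint law: `β` has i.i.d. entries with law `F`, `x ∼ N(0, I_k)`, `ε ∼ N(0, v)`, the two dataset
draws are i.i.d., and all of these are independent. -/
def sampleLaw (k n : ℕ) (F : Measure ℝ) (v : ℝ≥0) : Measure (Sample k n) :=
  (Measure.pi fun _ : Fin k => F).prod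
    (((Measure.pi fun _ : Fin k => gaussianReal 0 1).prod (gaussianReal 0 v)).prod
      (Measure.pi fun _ : Fin 2 => drawLaw k n v))

/-- The second moment `E[β_l²]`. -/
def secondMoment (F : Measure ℝ) : ℝ := ∫ b, b ^ 2 ∂F

/-- The submatrix of the covariate matrix whose columns are the covariates in `M`. -/
def subCov {k n : ℕ} (M : Finset (Fin k)) (X : Fin n → Fin k → ℝ) : Matrix (Fin n) M ℝ :=
  Matrix.of fun j l => X j l

/-- The outcomes `Y = X β + η` of a dataset. -/
def outcomes {k n : ℕ} (β : Fin k → ℝ) (D : Draw k n) : Fin n → ℝ :=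
  fun j => D.1 j ⬝ᵥ β + D.2 j

/-- The OLS estimator using the covariates in `M`: `(X_Mᵀ X_M)⁻¹ X_Mᵀ Y` on `M`,
and `0` outside `M`. -/
def ols {k n : ℕ} (M : Finset (Fin k)) (X : Fin n → Fin k → ℝ) (Y : Fin n → ℝ) : Fin k → ℝ :=
  fun l => if h : l ∈ M then
    (((subCov M X)ᵀ * subCov M X)⁻¹ *ᵥ ((subCov M X)ᵀ *ᵥ Y)) ⟨l, h⟩ else 0

/-- The estimator trained on the dataset with exogenous part `D` when the coefficients are `β`. -/
def betaHat {k n : ℕ} (M : Finset (Fin k)) (β : Fin k → ℝ) (D : Draw k n) : Fin k → ℝ :=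
  ols M D.1 (outcomes β D)

/-- The conditional mean of the estimator given `β`. -/
def meanBetaHat {k : ℕ} (n : ℕ) (v : ℝ≥0) (M : Finset (Fin k)) (β : Fin k → ℝ) : Fin k → ℝ :=
  fun l => ∫ D, betaHat M β D l ∂(drawLaw k n v)

/-- The outcome `y = xᵀ β + ε` the consumer wants to predict. -/
def outcome {k n : ℕ} (s : Sample k n) : ℝ := s.2.1.1 ⬝ᵥ s.1 + s.2.1.2

/-- The prediction `xᵀ β̂⁽ⁱ⁾` of firm `i` when it uses the covariates in `M`. -/
def prediction {k n : ℕ} (M : Finset (Fin k)) (i : Fin 2) (s : Sample k n) : ℝ :=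
  s.2.1.1 ⬝ᵥ betaHat M s.1 (s.2.2 i)

/-- The squared prediction error of firm `i`'s model. -/
def sqError {k n : ℕ} (M : Finset (Fin k)) (i : Fin 2) (s : Sample k n) : ℝ :=
  (outcome s - prediction M i s) ^ 2

/-- The squared bias of the model, given `β` and `x`. -/
def sqBias {k n : ℕ} (v : ℝ≥0) (M : Finset (Fin k)) (s : Sample k n) : ℝ :=
  (s.2.1.1 ⬝ᵥ s.1 - s.2.1.1 ⬝ᵥ meanBetaHat n v M s.1) ^ 2

/-- The squared deviation of firm `i`'s prediction from its mean given `β` and `x`. -/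
def sqDeviation {k n : ℕ} (v : ℝ≥0) (M : Finset (Fin k)) (i : Fin 2) (s : Sample k n) : ℝ :=
  (s.2.1.1 ⬝ᵥ meanBetaHat n v M s.1 - prediction M i s) ^ 2

/-! ### The market game -/

/-- The primitives of the two-firm market. `cost d` is the cost of entering with a model that has
`d` covariates, `outside` is the consumer's payoff if she buys nothing. -/
structure Market where
  k : ℕ
  n : ℕ
  lt_n : k + 1 < n
  coefLaw : Measure ℝ
  isProb : IsProbabilityMeasure coefLaw
  memLp : MemLp id 2 coefLaw
  noiseVar : ℝ≥0
  cost : ℕ → ℝ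
  cost_pos : ∀ d, 0 < cost d
  outside : ℝ
  outside_neg : outside < 0

namespace Market

/-- A firm's first-stage action: `none` is staying out, `some M` is entering with the OLS model
that uses the covariates in `M`. -/
abbrev Action (m : Market) : Type := Option (Finset (Fin m.k))

/-- A profile of first-stage actions of the two firms. -/
abbrev Profile (m : Market) : Type := Fin 2 → m.Action

/-- The firms that enter. -/
def entrants (m : Market) (a : m.Profile) : Finset (Fin 2) :=
  Finset.univ.filter fun i => (a i).isSome

/-- The cost of a first-stage action. -/
def actionCost (m : Market) : m.Action → ℝ
  | none => 0
  | some M => m.cost M.card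

/-- The prediction sold by firm `i` under a first-stage action (`0`, and never used, if the firm
stays out). -/
def actionPrediction (m : Market) (i : Fin 2) : m.Action → Sample m.k m.n → ℝ
  | none => fun _ => 0
  | some M => prediction M i

/-- The mean squared error of the weighted prediction `∑ i, w i * f̂_i(x)`. -/
def mse (m : Market) (a : m.Profile) (w : Fin 2 → ℝ) : ℝ :=
  ∫ s, (outcome s - ∑ i, w i * m.actionPrediction i (a i) s) ^ 2
    ∂(sampleLaw m.k m.n m.coefLaw m.noiseVar)

/-- Non-negative weights on the firms in `P` that sum to one. -/
def weights (P : Finset (Fin 2)) : Set (Fin 2 → ℝ) :=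
  {w | (∀ i, 0 ≤ w i) ∧ (∀ i, i ∉ P → w i = 0) ∧ ∑ i ∈ P, w i = 1}

/-- `U(P, a)`: minus the mean squared error when the consumer weights the models of the firms in `P`
optimally; the outside option if `P` is empty. -/
def utility (m : Market) (a : m.Profile) (P : Finset (Fin 2)) : ℝ :=
  if P = ∅ then m.outside else sSup ((fun w => -m.mse a w) '' weights P)

/-- Decreasing marginal returns. -/
def DecreasingMarginalReturns (m : Market) : Prop :=
  ∀ a : m.Profile, ∀ E ⊆ m.entrants a, ∀ E' ⊆ E, ∀ j ∈ E',
    m.utility a E - m.utility a (E.erase j) ≤ m.utility a E' - m.utility a (E'.erase j)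

/-- A decision of the consumer: the set of firms she buys from and the weights she uses. -/
abbrev Purchase : Type := Finset (Fin 2) × (Fin 2 → ℝ)

/-- The consumer can buy only from entrants, and needs weights if she buys at all. -/
def Feasible (m : Market) (a : m.Profile) (z : Purchase) : Prop :=
  z.1 ⊆ m.entrants a ∧ (z.1.Nonempty → z.2 ∈ weights z.1)

/-- The consumer's payoff from decision `z` at models `a` and prices `p`. -/
def consumerPayoff (m : Market) (a : m.Profile) (p : Fin 2 → ℝ) (z : Purchase) : ℝ :=
  (if z.1 = ∅ then m.outside else -m.mse a z.2) - ∑ i ∈ z.1, p i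

/-- A pure strategy profile. Firms choose models, then, having observed all model choices, prices;
the consumer observes models and prices. (The price of a firm that stayed out affects no
payoff.) -/
structure Strategy (m : Market) where
  model : m.Profile
  price : m.Profile → Fin 2 → ℝ
  buy : m.Profile → (Fin 2 → ℝ) → Purchase

/-- Firm `i`'s profit at models `a` and prices `p`, given the consumer's strategy. -/
def profit (m : Market) (buy : m.Profile → (Fin 2 → ℝ) → Purchase) (i : Fin 2)
    (a : m.Profile) (p : Fin 2 → ℝ) : ℝ :=
  (if i ∈ (buy a p).1 then p i else 0) - m.actionCost (a i)

/-- Pure-strategy subgame perfect Nash equilibrium: the strategies are a Nash equilibrium of each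
subgame, that is, of the consumer's problem after all models and prices, of the pricing game
after all models, and of the whole game (where a firm may change both its model and its price). -/
structure IsSPNE (m : Market) (S : m.Strategy) : Prop where
  feasible : ∀ a p, m.Feasible a (S.buy a p)
  consumer : ∀ a p z, m.Feasible a z → m.consumerPayoff a p z ≤ m.consumerPayoff a p (S.buy a p)
  pricing : ∀ a i q,
    m.profit S.buy i a (Function.update (S.price a) i q) ≤ m.profit S.buy i a (S.price a)
  entry : ∀ i b q,
    m.profit S.buy i (Function.update S.model i b)
        (Function.update (S.price (Function.update S.model i b)) i q) ≤
      m.profit S.buy i S.model (S.price S.model)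

end Market

end OLSMarket

end

noncomputable section

namespace OLSMarket

open scoped ENNReal

/-! ### Gaussian vectors and the inverse Gram matrix -/

/-! Prediction error. Given β, the estimation error on M is (X_MᵀX_M)⁻¹X_Mᵀu, where u collects the
omitted covariates and the noise. The entries of u are centred, uncorrelated, of variance ω =
Σ_{l∉M} β_l² + σ², and independent of X_M. So the estimator is unbiased on M, and its l-th
coordinate has mean squared error ω·E[((X_MᵀX_M)⁻¹)_ll]. That diagonal entry is the inverse squared
length of the projection of column l onto the orthogonal complement of the other columns
(`inv_colGram_diag_mul`), an inverse chi-square with n − |M| + 1 degrees of freedom and mean 1/(n −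
|M| − 1) (`lintegral_inv_colGram`). As x has identity covariance, prediction errors are sums over
coordinates (`integral_query_sq`).

Two firms are independent given β, so their errors have mean product C(M₀, M₁) = σ² + β̄²(k − |M₀ ∪
M₁|), and the error of a weighted pair is an explicit quadratic in the weights
(`integral_weighted_error`).

Game. With two entrants, both must sell to cover their costs, and the consumer can drop either, so a
price is at most the firm's marginal contribution. Under decreasing returns any lower price sells,
whatever the rival charges. Hence an equilibrium model maximizes the payoff of the pair net of cost,
given the rival's model (`IsSPNE.duo_deviation_le`). For identical models the marginal contribution
is half the variance V (`duoUtility_self`), so entry requires c(|M|) ≤ V/2.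

Costly covariates: increasing convex costs bound |M| independently of k, and then V tends to 0 as k
grows, below c(0).

Costless covariates: the regime yields β̄²(n − 1 − k) < σ². Then swapping a covariate, or dropping
one from the full model, makes a firm more useful next to its twin, so identical models are not an
equilibrium. For existence, the payoff of the pair is a potential: a maximizing pair, priced at
marginal contributions, is an equilibrium (`DecreasingMarginalReturns.exists_isSPNE`). Entry pays
because every single model is at most as good as the empty one, while two disjoint models of k/4
covariates beat it by at least β̄²k/32. -/

lemma integrable_exp_neg_mul_sq_gaussian {t : ℝ} (ht : 0 ≤ t) :
    Integrable (fun y : ℝ => Real.exp (-t * y ^ 2)) (gaussianReal 0 1) := by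
  refine Integrable.of_bound (C := 1) (by fun_prop) (ae_of_all _ fun y => ?_)
  rw [Real.norm_eq_abs, abs_of_pos (Real.exp_pos _), Real.exp_le_one_iff]
  nlinarith [sq_nonneg y]

lemma integral_exp_neg_mul_sq_gaussian {t : ℝ} (ht : 0 ≤ t) :
    ∫ y, Real.exp (-t * y ^ 2) ∂(gaussianReal 0 1) = (1 + 2 * t) ^ (-(1 / 2) : ℝ) := by
  rw [integral_gaussianReal_eq_integral_smul one_ne_zero]
  have h : ∀ y : ℝ, gaussianPDFReal 0 1 y • Real.exp (-t * y ^ 2)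
      = (√(2 * Real.pi))⁻¹ * Real.exp (-(t + 1 / 2) * y ^ 2) := by
    intro y
    rw [gaussianPDFReal, smul_eq_mul, mul_assoc, ← Real.exp_add]
    simp only [NNReal.coe_one, mul_one, sub_zero]
    ring_nf
  simp_rw [h]
  rw [integral_const_mul, integral_gaussian, Real.rpow_neg (by positivity), ← Real.sqrt_eq_rpow,
    ← Real.sqrt_inv, ← Real.sqrt_inv, ← Real.sqrt_mul (by positivity)]
  congr 1
  have := Real.pi_pos
  field_simp
  ring

lemma lintegral_exp_neg_mul_sum_sq {ι : Type*} [Fintype ι] {t : ℝ} (ht : 0 ≤ t) :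
    ∫⁻ y, ENNReal.ofReal (Real.exp (-t * ∑ i, y i ^ 2))
        ∂(Measure.pi fun _ : ι => gaussianReal 0 1) =
      ENNReal.ofReal ((1 + 2 * t) ^ (-(Fintype.card ι / 2) : ℝ)) := by
  have h : ∀ y : ι → ℝ, Real.exp (-t * ∑ i, y i ^ 2) = ∏ i, Real.exp (-t * y i ^ 2) := by
    intro y
    rw [Finset.mul_sum, Real.exp_sum]
  simp_rw [h]
  rw [← ofReal_integral_eq_lintegral_ofReal
    (Integrable.fintype_prod fun _ => integrable_exp_neg_mul_sq_gaussian ht)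
    (ae_of_all _ fun y => by positivity), integral_fintype_prod_eq_prod
    (fun _ : ι => fun y : ℝ => Real.exp (-t * y ^ 2))]
  simp_rw [integral_exp_neg_mul_sq_gaussian ht]
  rw [Finset.prod_const, ← Real.rpow_natCast, ← Real.rpow_mul (by positivity), Finset.card_univ]
  congr 2
  ring

/-- Working in `ENNReal` makes both sides infinite at s = 0, so no null set has to be removed before
integrals are exchanged. -/
lemma lintegral_exp_neg_mul_Ioi {s : ℝ} (hs : 0 ≤ s) :
    ∫⁻ t in Set.Ioi (0 : ℝ), ENNReal.ofReal (Real.exp (-t * s)) = (ENNReal.ofReal s)⁻¹ := by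
  rcases hs.eq_or_lt with rfl | hs
  · simp
  · rw [← ofReal_integral_eq_lintegral_ofReal]
    · simp_rw [show ∀ t : ℝ, -t * s = -s * t from fun t => by ring]
      rw [integral_exp_mul_Ioi (by linarith), ← ENNReal.ofReal_inv_of_pos hs]
      congr 1
      simp
    · simp_rw [show ∀ t : ℝ, -t * s = -s * t from fun t => by ring]
      exact exp_neg_integrableOn_Ioi 0 hs
    · exact ae_of_all _ fun t => (Real.exp_pos _).le

lemma lintegral_one_add_two_mul_rpow {m : ℝ} (hm : 2 < m) :
    ∫⁻ t in Set.Ioi (0 : ℝ), ENNReal.ofReal ((1 + 2 * t) ^ (-(m / 2))) =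
      ENNReal.ofReal (m - 2)⁻¹ := by
  -- This antiderivative vanishes at infinity because 1 − m/2 is negative; its value at 0 gives the
  -- integral.
  have hd : ∀ x ∈ Set.Ici (0 : ℝ), HasDerivAt (fun t : ℝ => -(m - 2)⁻¹ * (1 + 2 * t) ^ (1 - m / 2))
      ((1 + 2 * x) ^ (-(m / 2))) x := by
    intro x hx
    have hx : (0 : ℝ) ≤ x := hx
    have h1 : HasDerivAt (fun t : ℝ => 1 + 2 * t) 2 x := by
      simpa using ((hasDerivAt_id x).const_mul 2).const_add 1
    have := (h1.rpow_const (p := 1 - m / 2) (Or.inl (by positivity))).const_mul (-(m - 2)⁻¹)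
    refine this.congr_deriv ?_
    rw [show 1 - m / 2 - 1 = -(m / 2) by ring]
    have : m - 2 ≠ 0 := by linarith
    field_simp
    ring
  have hlim : Filter.Tendsto (fun t : ℝ => -(m - 2)⁻¹ * (1 + 2 * t) ^ (1 - m / 2)) Filter.atTop
      (nhds (-(m - 2)⁻¹ * 0)) := by
    refine Filter.Tendsto.const_mul _ ?_
    rw [show 1 - m / 2 = -(m / 2 - 1) by ring]
    refine (tendsto_rpow_neg_atTop (by linarith)).comp ?_
    exact Filter.tendsto_atTop_add_const_left _ _
      (Filter.tendsto_id.const_mul_atTop (by norm_num))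
  have hpos : ∀ x ∈ Set.Ioi (0 : ℝ), (0 : ℝ) ≤ (1 + 2 * x) ^ (-(m / 2)) := by
    intro x hx
    have hx : (0 : ℝ) < x := hx
    positivity
  have hi := integrableOn_Ioi_deriv_of_nonneg' hd hpos hlim
  rw [← ofReal_integral_eq_lintegral_ofReal hi
    ((ae_restrict_iff' measurableSet_Ioi).2 (ae_of_all _ hpos)),
    integral_Ioi_of_hasDerivAt_of_nonneg' hd hpos hlim]
  simp

/-- Write 1/s as the integral of exp(−ts) over t > 0 and exchange integrals: the Laplace transform
of the chi-square law is (1 + 2t)^(−m/2), integrable because m > 2. -/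
lemma lintegral_inv_sum_sq {ι : Type*} [Fintype ι] (hι : 2 < Fintype.card ι) :
    ∫⁻ y, (ENNReal.ofReal (∑ i, y i ^ 2))⁻¹ ∂(Measure.pi fun _ : ι => gaussianReal 0 1) =
      ENNReal.ofReal ((Fintype.card ι : ℝ) - 2)⁻¹ := by
  have h : ∀ y : ι → ℝ, (ENNReal.ofReal (∑ i, y i ^ 2))⁻¹ =
      ∫⁻ t in Set.Ioi (0 : ℝ), ENNReal.ofReal (Real.exp (-t * ∑ i, y i ^ 2)) := fun y =>
    (lintegral_exp_neg_mul_Ioi (Finset.sum_nonneg fun i _ => sq_nonneg _)).symm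
  simp_rw [h]
  rw [lintegral_lintegral_swap]
  · rw [← lintegral_one_add_two_mul_rpow (by exact_mod_cast hι)]
    refine setLIntegral_congr_fun measurableSet_Ioi fun t ht => ?_
    exact lintegral_exp_neg_mul_sum_sq (le_of_lt ht)
  · refine Measurable.aemeasurable ?_
    unfold Function.uncurry
    fun_prop

/-- The characteristic functional of a standard Gaussian sees a functional L only through ‖L‖, and
composing L with the projection keeps this norm: the projection is a contraction and fixes U. -/
lemma stdGaussian_map_orthogonalProjection {E : Type*} [NormedAddCommGroup E]
    [InnerProductSpace ℝ E] [FiniteDimensional ℝ E] [MeasurableSpace E] [BorelSpace E]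
    (U : Submodule ℝ E) : (stdGaussian E).map U.orthogonalProjectionOnto = stdGaussian U := by
  apply Measure.ext_of_charFunDual
  ext L
  rw [charFunDual_map, charFunDual_stdGaussian, charFunDual_stdGaussian]
  suffices h : ‖L ∘L U.orthogonalProjectionOnto‖ = ‖L‖ by rw [h]
  refine le_antisymm ?_ ?_
  · calc ‖L ∘L U.orthogonalProjectionOnto‖ ≤ ‖L‖ * ‖U.orthogonalProjectionOnto‖ :=
        ContinuousLinearMap.opNorm_comp_le _ _
      _ ≤ ‖L‖ * 1 := by gcongr; exact U.orthogonalProjectionOnto_norm_le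
      _ = ‖L‖ := mul_one _
  · refine ContinuousLinearMap.opNorm_le_bound _ (norm_nonneg _) fun u => ?_
    have := (L ∘L U.orthogonalProjectionOnto).le_opNorm u
    simpa using this

lemma lintegral_inv_norm_sq_stdGaussian {E : Type*} [NormedAddCommGroup E]
    [InnerProductSpace ℝ E] [FiniteDimensional ℝ E] [MeasurableSpace E] [BorelSpace E]
    (hE : 2 < Module.finrank ℝ E) :
    ∫⁻ x, (ENNReal.ofReal (‖x‖ ^ 2))⁻¹ ∂(stdGaussian E) =
      ENNReal.ofReal ((Module.finrank ℝ E : ℝ) - 2)⁻¹ := by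
  rw [stdGaussian_eq_map_pi_orthonormalBasis (stdOrthonormalBasis ℝ E), lintegral_map
    (by fun_prop) (by fun_prop)]
  have h : ∀ x : Fin (Module.finrank ℝ E) → ℝ, ‖∑ i, x i • stdOrthonormalBasis ℝ E i‖ ^ 2 =
      ∑ i, x i ^ 2 := by
    intro x
    rw [← real_inner_self_eq_norm_sq, (stdOrthonormalBasis ℝ E).orthonormal.inner_sum]
    simp [sq]
  simp_rw [h]
  simpa using lintegral_inv_sum_sq (ι := Fin (Module.finrank ℝ E)) (by simpa using hE)

lemma lintegral_inv_norm_sq_projection {n : ℕ} (U : Submodule ℝ (EuclideanSpace ℝ (Fin n)))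
    (hU : 2 < Module.finrank ℝ U) :
    ∫⁻ x, (ENNReal.ofReal (‖U.orthogonalProjectionOnto (WithLp.toLp 2 x)‖ ^ 2))⁻¹
        ∂(Measure.pi fun _ : Fin n => gaussianReal 0 1) =
      ENNReal.ofReal ((Module.finrank ℝ U : ℝ) - 2)⁻¹ := by
  rw [← lintegral_inv_norm_sq_stdGaussian hU, ← stdGaussian_map_orthogonalProjection U,
    ← map_pi_eq_stdGaussian, lintegral_map (by fun_prop) (by fun_prop),
    lintegral_map (by fun_prop) (by fun_prop)]

/-! ### The inverse Gram matrix of independent Gaussian columns. -/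

/-- The Gram matrix of a family of vectors. -/
def colGram {ι : Type*} {n : ℕ} (W : ι → Fin n → ℝ) : Matrix ι ι ℝ :=
  Matrix.of fun l m => W l ⬝ᵥ W m

lemma colGram_eq_gram {ι : Type*} {n : ℕ} (W : ι → Fin n → ℝ) :
    colGram W = Matrix.gram ℝ (fun l => (WithLp.toLp 2 (W l) : EuclideanSpace ℝ (Fin n))) := by
  ext l m
  simp [colGram, Matrix.gram_apply, EuclideanSpace.inner_eq_star_dotProduct, dotProduct_comm]

lemma linearIndependent_toLp_iff {ι : Type*} {n : ℕ} {W : ι → Fin n → ℝ} :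
    LinearIndependent ℝ (fun l => (WithLp.toLp 2 (W l) : EuclideanSpace ℝ (Fin n))) ↔
      LinearIndependent ℝ W :=
  ((WithLp.linearEquiv 2 ℝ (Fin n → ℝ)).symm.toLinearMap.linearIndependent_iff_of_injOn
    (WithLp.linearEquiv 2 ℝ (Fin n → ℝ)).symm.injective.injOn)

lemma isUnit_det_colGram {ι : Type*} [Fintype ι] [DecidableEq ι] {n : ℕ} {W : ι → Fin n → ℝ}
    (hW : LinearIndependent ℝ W) : IsUnit (colGram W).det := by
  rw [isUnit_iff_ne_zero, colGram_eq_gram, Matrix.det_gram_ne_zero_iff_linearIndependent]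
  exact linearIndependent_toLp_iff.2 hW

/-- The orthogonal complement of the span of a set of vectors. -/
def spanPerp {n : ℕ} (s : Set (Fin n → ℝ)) : Submodule ℝ (EuclideanSpace ℝ (Fin n)) :=
  (Submodule.span ℝ (WithLp.toLp 2 '' s))ᗮ

lemma finrank_spanPerp {n d : ℕ} {V : Fin d → Fin n → ℝ} (hV : LinearIndependent ℝ V) :
    Module.finrank ℝ (spanPerp (Set.range V)) + d = n := by
  have h := Submodule.finrank_add_finrank_orthogonal
    (Submodule.span ℝ (WithLp.toLp 2 '' (Set.range V) : Set (EuclideanSpace ℝ (Fin n))))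
  have hV' : LinearIndependent ℝ
      ((WithLp.toLp 2 : (Fin n → ℝ) → EuclideanSpace ℝ (Fin n)) ∘ V) :=
    linearIndependent_toLp_iff.2 hV
  rw [← Set.range_comp, finrank_span_eq_card hV',
    finrank_euclideanSpace, Fintype.card_fin, Fintype.card_fin] at h
  rw [spanPerp, ← Set.range_comp, add_comm]
  exact h

/-- Row l of the inverse Gram matrix gives the dual vector r, with ⟨r, w_m⟩ = δ_lm; it is orthogonal
to the other columns. For the projection p of w_l, compute ⟨r, p⟩ twice: it equals ⟨r, w_l⟩ = 1,
and, since p is orthogonal to the other columns, it equals the diagonal entry times ⟨w_l, p⟩ = ‖p‖².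
-/
lemma inv_colGram_diag_mul {ι : Type*} [Fintype ι] [DecidableEq ι] {n : ℕ} {W : ι → Fin n → ℝ}
    (hW : LinearIndependent ℝ W) (l : ι) :
    (colGram W)⁻¹ l l *
      ‖(spanPerp (W '' {l}ᶜ)).orthogonalProjectionOnto (WithLp.toLp 2 (W l))‖ ^ 2 = 1 := by
  set S : Submodule ℝ (EuclideanSpace ℝ (Fin n)) :=
    Submodule.span ℝ (WithLp.toLp 2 '' (W '' {l}ᶜ)) with hS
  set w : ι → EuclideanSpace ℝ (Fin n) := fun m => WithLp.toLp 2 (W m) with hw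
  set H := (colGram W)⁻¹ with hH
  have hHG : H * colGram W = 1 := Matrix.nonsing_inv_mul _ (isUnit_det_colGram hW)
  set r : EuclideanSpace ℝ (Fin n) := ∑ m, H l m • w m with hr
  have hrw : ∀ m, inner ℝ r (w m) = if l = m then (1 : ℝ) else 0 := by
    intro m
    have := congrFun (congrFun hHG l) m
    rw [Matrix.mul_apply, Matrix.one_apply] at this
    rw [← this, hr, sum_inner]
    refine Finset.sum_congr rfl fun i _ => ?_
    rw [real_inner_smul_left, colGram_eq_gram, Matrix.gram_apply]
  have hrS : r ∈ Sᗮ := by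
    rw [Submodule.mem_orthogonal']
    intro u hu
    induction hu using Submodule.span_induction with
    | mem x hx =>
      obtain ⟨_, ⟨m, hm, rfl⟩, rfl⟩ := hx
      have := hrw m
      rw [if_neg (fun h => hm h.symm)] at this
      exact this
    | zero => simp
    | add x y _ _ hx hy => rw [inner_add_right, hx, hy, add_zero]
    | smul a x _ hx => rw [inner_smul_right, hx, mul_zero]
  set p : EuclideanSpace ℝ (Fin n) := (Sᗮ.orthogonalProjectionOnto (w l) : EuclideanSpace ℝ (Fin n))
    with hp
  have hpS : p ∈ Sᗮ := Subtype.prop _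
  have hpw : ∀ m, m ≠ l → inner ℝ (w m) p = 0 := fun m hm =>
    (Submodule.mem_orthogonal _ _).1 hpS _ (Submodule.subset_span ⟨_, ⟨m, hm, rfl⟩, rfl⟩)
  have horth : ∀ u ∈ Sᗮ, inner ℝ u p = inner ℝ u (w l) := by
    intro u hu
    have h := Submodule.starProjection_inner_eq_zero (K := Sᗮ) (w l) u hu
    rw [real_inner_comm, inner_sub_right, sub_eq_zero] at h
    exact h.symm
  have h1 : inner ℝ r p = (1 : ℝ) := by rw [horth r hrS, hrw, if_pos rfl]
  have h2 : inner ℝ r p = H l l * inner ℝ (w l) p := by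
    rw [hr, sum_inner, Finset.sum_eq_single l]
    · rw [real_inner_smul_left]
    · intro m _ hm
      rw [real_inner_smul_left, hpw m hm, mul_zero]
    · simp
  have h3 : ‖Sᗮ.orthogonalProjectionOnto (w l)‖ ^ 2 = inner ℝ (w l) p := by
    rw [real_inner_comm, ← horth p hpS, real_inner_self_eq_norm_sq]
    rfl
  change H l l * ‖Sᗮ.orthogonalProjectionOnto (w l)‖ ^ 2 = 1
  rw [h3, ← h2, h1]

/-- The standard Gaussian law of a vector. -/
abbrev gaussVec (n : ℕ) : Measure (Fin n → ℝ) := Measure.pi fun _ => gaussianReal 0 1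

/-- On the span the projection vanishes and its inverse square is infinite, while the mean of that
inverse is finite. The mean requires a complement of dimension above 2, whence d + 2 < n. -/
lemma ae_notMem_span_gaussVec {n d : ℕ} (hd : d + 2 < n) {V : Fin d → Fin n → ℝ}
    (hV : LinearIndependent ℝ V) :
    ∀ᵐ x ∂(gaussVec n), x ∉ Submodule.span ℝ (Set.range V) := by
  have hU := finrank_spanPerp hV
  have h := lintegral_inv_norm_sq_projection (spanPerp (Set.range V)) (by omega)
  have hfin := ae_lt_top (μ := gaussVec n) (f := fun x => (ENNReal.ofReal
    (‖(spanPerp (Set.range V)).orthogonalProjectionOnto (WithLp.toLp 2 x)‖ ^ 2))⁻¹)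
    (by fun_prop) (by rw [h]; exact ENNReal.ofReal_ne_top)
  filter_upwards [hfin] with x hx hmem
  have hmem' : (WithLp.toLp 2 x : EuclideanSpace ℝ (Fin n)) ∈
      Submodule.span ℝ (WithLp.toLp 2 '' (Set.range V)) := by
    have := Submodule.mem_map_of_mem (f := (WithLp.linearEquiv 2 ℝ (Fin n → ℝ)).symm.toLinearMap) hmem
    rw [Submodule.map_span] at this
    exact this
  have : (spanPerp (Set.range V)).orthogonalProjectionOnto (WithLp.toLp 2 x) = 0 := by
    rw [Submodule.orthogonalProjectionOnto_eq_zero_iff, spanPerp,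
      Submodule.orthogonal_orthogonal]
    exact hmem'
  rw [this] at hx
  simp at hx

lemma measurableSet_linearIndependent {ι : Type*} [Finite ι] {n : ℕ} :
    MeasurableSet {W : ι → Fin n → ℝ | LinearIndependent ℝ W} := by
  cases nonempty_fintype ι
  exact isOpen_setOfPred_linearIndependent.measurableSet

lemma ae_linearIndependent_fin {n d : ℕ} (hd : d + 1 < n) :
    ∀ᵐ W ∂(Measure.pi fun _ : Fin d => gaussVec n), LinearIndependent ℝ W := by
  induction d with
  | zero => exact ae_of_all _ fun W => linearIndependent_empty_type
  | succ d ih =>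
    have hmp := (measurePreserving_piFinSuccAbove (fun _ : Fin (d + 1) => gaussVec n) 0).symm
    have key : ∀ᵐ q ∂((gaussVec n).prod (Measure.pi fun _ : Fin d => gaussVec n)),
        LinearIndependent ℝ (Fin.cons q.1 q.2 : Fin (d + 1) → Fin n → ℝ) := by
      have hm : MeasurableSet {q : (Fin n → ℝ) × (Fin d → Fin n → ℝ) |
          LinearIndependent ℝ (Fin.cons q.1 q.2 : Fin (d + 1) → Fin n → ℝ)} := by
        refine measurableSet_linearIndependent.preimage
          (f := fun q : (Fin n → ℝ) × (Fin d → Fin n → ℝ) => (Fin.cons q.1 q.2 : Fin (d + 1) → Fin n → ℝ)) ?_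
        refine measurable_pi_iff.2 fun j => ?_
        refine Fin.cases ?_ (fun j => ?_) j <;> simp <;> fun_prop
      -- Fubini in the reversed order: freeze the d old columns, then let the new one avoid their
      -- span.
      rw [Measure.ae_prod_iff_ae_ae hm, Measure.ae_ae_comm hm]
      filter_upwards [ih (by omega)] with V hV
      filter_upwards [ae_notMem_span_gaussVec (by omega) hV] with x hx
      exact linearIndependent_finCons.2 ⟨hV, hx⟩
    rw [← hmp.map_eq, ae_map_iff hmp.measurable.aemeasurable measurableSet_linearIndependent]
    filter_upwards [key] with q hq
    simpa [MeasurableEquiv.piFinSuccAbove, Fin.insertNthEquiv] using hq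

lemma ae_linearIndependent {ι : Type*} [Fintype ι] {n : ℕ} (hd : Fintype.card ι + 1 < n) :
    ∀ᵐ W ∂(Measure.pi fun _ : ι => gaussVec n), LinearIndependent ℝ W := by
  have e := (Fintype.equivFin ι).symm
  have hmp := measurePreserving_piCongrLeft (fun _ : ι => gaussVec n) e
  rw [← hmp.map_eq, ae_map_iff hmp.measurable.aemeasurable measurableSet_linearIndependent]
  filter_upwards [ae_linearIndependent_fin hd] with W hW
  rw [← linearIndependent_equiv e]
  convert hW
  ext i j
  simp [MeasurableEquiv.coe_piCongrLeft, Equiv.piCongrLeft_apply_apply]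

lemma measurable_inv_colGram {ι : Type*} [Fintype ι] [DecidableEq ι] {n : ℕ} (l m : ι) :
    Measurable fun W : ι → Fin n → ℝ => (colGram W)⁻¹ l m := by
  have hc : Continuous fun W : ι → Fin n → ℝ => colGram W := by
    refine continuous_matrix fun i j => ?_
    simp only [colGram, Matrix.of_apply, dotProduct]
    fun_prop
  simp_rw [Matrix.inv_def, Matrix.smul_apply, Ring.inverse_eq_inv', smul_eq_mul]
  exact (hc.matrix_det.measurable.inv).mul (hc.matrix_adjugate.matrix_elem l m).measurable

/-- Freeze all columns except l. The remaining randomness is a Gaussian vector projected onto a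
space of dimension n − d, which gives the same mean for almost all frozen columns. -/
lemma lintegral_inv_colGram_fin {n d : ℕ} (hd : d + 2 < n) (l : Fin (d + 1)) :
    ∫⁻ W, ENNReal.ofReal ((colGram W)⁻¹ l l) ∂(Measure.pi fun _ : Fin (d + 1) => gaussVec n) =
      ENNReal.ofReal ((n : ℝ) - d - 2)⁻¹ := by
  have hmp := (measurePreserving_piFinSuccAbove (fun _ : Fin (d + 1) => gaussVec n) l).symm
  have hae := ae_linearIndependent_fin (n := n) (d := d + 1) hd
  rw [← hmp.map_eq] at hae ⊢
  rw [ae_map_iff hmp.measurable.aemeasurable measurableSet_linearIndependent] at hae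
  have hmeas : Measurable fun W : Fin (d + 1) → Fin n → ℝ => ENNReal.ofReal ((colGram W)⁻¹ l l) :=
    (measurable_inv_colGram l l).ennreal_ofReal
  have hms : MeasurableSet {q | LinearIndependent ℝ
      ((MeasurableEquiv.piFinSuccAbove (fun _ => Fin n → ℝ) l).symm q)} :=
    hmp.measurable measurableSet_linearIndependent
  rw [Measure.ae_prod_iff_ae_ae hms, Measure.ae_ae_comm hms] at hae
  rw [lintegral_map hmeas hmp.measurable]
  refine (lintegral_prod_symm (fun q => ENNReal.ofReal ((colGram
    ((MeasurableEquiv.piFinSuccAbove (fun _ => Fin n → ℝ) l).symm q))⁻¹ l l))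
    (hmeas.comp hmp.measurable).aemeasurable).trans ?_
  have hconst : ∀ᵐ V ∂(Measure.pi fun _ : Fin d => gaussVec n),
      ∫⁻ x, ENNReal.ofReal ((colGram
        ((MeasurableEquiv.piFinSuccAbove (fun _ => Fin n → ℝ) l).symm (x, V)))⁻¹ l l) ∂(gaussVec n) =
      ENNReal.ofReal ((n : ℝ) - d - 2)⁻¹ := by
    filter_upwards [hae] with V hV
    have hcomp : ∀ x : Fin n → ℝ, ((MeasurableEquiv.piFinSuccAbove (fun _ => Fin n → ℝ) l).symm (x, V)) ∘
        l.succAbove = V := by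
      intro x
      ext j i
      simp [MeasurableEquiv.piFinSuccAbove, Fin.insertNthEquiv]
    have hat : ∀ x : Fin n → ℝ,
        ((MeasurableEquiv.piFinSuccAbove (fun _ => Fin n → ℝ) l).symm (x, V)) l = x := by
      intro x
      simp [MeasurableEquiv.piFinSuccAbove, Fin.insertNthEquiv]
    -- One column completing V to an independent family already shows that V is independent.
    obtain ⟨x₀, hx₀⟩ := hV.exists
    have hVi : LinearIndependent ℝ V := by
      rw [← hcomp x₀]
      exact hx₀.comp _ Fin.succAbove_right_injective
    have hfr := finrank_spanPerp hVi
    have hfr' : (Module.finrank ℝ (spanPerp (Set.range V)) : ℝ) + d = n := by exact_mod_cast hfr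
    rw [show (n : ℝ) - d - 2 = (Module.finrank ℝ (spanPerp (Set.range V)) : ℝ) - 2 by
      linarith, ← lintegral_inv_norm_sq_projection _ (by omega)]
    refine lintegral_congr_ae ?_
    filter_upwards [hV] with x hx
    have h1 := inv_colGram_diag_mul hx l
    rw [← Fin.range_succAbove, ← Set.range_comp, hcomp, hat] at h1
    rw [eq_inv_of_mul_eq_one_left h1, ENNReal.ofReal_inv_of_pos]
    refine lt_of_le_of_ne (by positivity) fun h0 => ?_
    rw [← h0, mul_zero] at h1
    exact zero_ne_one h1
  rw [lintegral_congr_ae hconst, lintegral_const, measure_univ, mul_one]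

lemma lintegral_inv_colGram {ι : Type*} [Fintype ι] [DecidableEq ι] {n : ℕ}
    (hd : Fintype.card ι + 1 < n) (l : ι) :
    ∫⁻ W, ENNReal.ofReal ((colGram W)⁻¹ l l) ∂(Measure.pi fun _ : ι => gaussVec n) =
      ENNReal.ofReal ((n : ℝ) - Fintype.card ι - 1)⁻¹ := by
  obtain ⟨d, hd'⟩ : ∃ d, Fintype.card ι = d + 1 :=
    ⟨Fintype.card ι - 1, (Nat.succ_pred_eq_of_pos (Fintype.card_pos_iff.2 ⟨l⟩)).symm⟩
  have e : Fin (d + 1) ≃ ι := (Fintype.equivFinOfCardEq hd').symm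
  have hmp := measurePreserving_piCongrLeft (fun _ : ι => gaussVec n) e
  rw [← hmp.map_eq, lintegral_map (measurable_inv_colGram l l).ennreal_ofReal hmp.measurable, hd']
  have := lintegral_inv_colGram_fin (n := n) (d := d) (by omega) (e.symm l)
  push_cast
  rw [show (n : ℝ) - (d + 1) - 1 = n - d - 2 by ring, ← this]
  refine lintegral_congr fun W => ?_
  congr 1
  have h : colGram W = (colGram (MeasurableEquiv.piCongrLeft (fun _ => Fin n → ℝ) e W)).submatrix e e := by
    ext i j
    simp [colGram, MeasurableEquiv.coe_piCongrLeft, Equiv.piCongrLeft_apply_apply]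
  rw [h, Matrix.inv_submatrix_equiv]
  simp

lemma inv_colGram_diag_nonneg {ι : Type*} [Fintype ι] [DecidableEq ι] {n : ℕ} {W : ι → Fin n → ℝ}
    (hW : LinearIndependent ℝ W) (l : ι) : 0 ≤ (colGram W)⁻¹ l l := by
  rw [eq_inv_of_mul_eq_one_left (inv_colGram_diag_mul hW l)]
  positivity

lemma integrable_inv_colGram {ι : Type*} [Fintype ι] [DecidableEq ι] {n : ℕ}
    (hd : Fintype.card ι + 1 < n) (l : ι) :
    Integrable (fun W => (colGram W)⁻¹ l l) (Measure.pi fun _ : ι => gaussVec n) := by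
  refine ⟨(measurable_inv_colGram l l).aestronglyMeasurable, ?_⟩
  rw [hasFiniteIntegral_iff_ofReal, lintegral_inv_colGram hd l]
  · exact ENNReal.ofReal_lt_top
  · filter_upwards [ae_linearIndependent hd] with W hW using inv_colGram_diag_nonneg hW l

lemma integral_inv_colGram {ι : Type*} [Fintype ι] [DecidableEq ι] {n : ℕ}
    (hd : Fintype.card ι + 1 < n) (l : ι) :
    ∫ W, (colGram W)⁻¹ l l ∂(Measure.pi fun _ : ι => gaussVec n) =
      ((n : ℝ) - Fintype.card ι - 1)⁻¹ := by
  have hd' : (Fintype.card ι : ℝ) + 1 < n := by exact_mod_cast hd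
  rw [integral_eq_lintegral_of_nonneg_ae _ (measurable_inv_colGram l l).aestronglyMeasurable,
    lintegral_inv_colGram hd l, ENNReal.toReal_ofReal (inv_nonneg.2 (by linarith))]
  filter_upwards [ae_linearIndependent hd] with W hW using inv_colGram_diag_nonneg hW l

/-! ### Moments of the rows of the pseudo-inverse. -/

/-- The rows of `(Wᵀ W)⁻¹ Wᵀ`, where `W` is the matrix with the given columns. -/
def pinv {ι : Type*} [Fintype ι] [DecidableEq ι] {n : ℕ} (W : ι → Fin n → ℝ) (l : ι) : Fin n → ℝ :=
  fun j => ∑ m, (colGram W)⁻¹ l m * W m j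

lemma pinv_dotProduct {ι : Type*} [Fintype ι] [DecidableEq ι] {n : ℕ} {W : ι → Fin n → ℝ}
    (hW : LinearIndependent ℝ W) (l m : ι) : pinv W l ⬝ᵥ W m = if l = m then 1 else 0 := by
  have h := congrFun (congrFun (Matrix.nonsing_inv_mul _ (isUnit_det_colGram hW)) l) m
  rw [Matrix.mul_apply, Matrix.one_apply] at h
  rw [← h]
  simp only [pinv, dotProduct, colGram, Matrix.of_apply, Finset.sum_mul, Finset.mul_sum]
  rw [Finset.sum_comm]
  simp only [mul_assoc]

/-- The row is a combination of the columns of W and also dual to them, so only its own coefficient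
survives. -/
lemma pinv_dotProduct_self {ι : Type*} [Fintype ι] [DecidableEq ι] {n : ℕ} {W : ι → Fin n → ℝ}
    (hW : LinearIndependent ℝ W) (l : ι) : pinv W l ⬝ᵥ pinv W l = (colGram W)⁻¹ l l := by
  have h : pinv W l = ∑ m, (colGram W)⁻¹ l m • W m := by
    ext j
    simp [pinv]
  have h2 : pinv W l ⬝ᵥ pinv W l = pinv W l ⬝ᵥ ∑ m, (colGram W)⁻¹ l m • W m := by rw [← h]
  rw [h2, dotProduct_sum, Finset.sum_eq_single l]
  · rw [dotProduct_smul, pinv_dotProduct hW, if_pos rfl, smul_eq_mul, mul_one]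
  · intro m _ hm
    rw [dotProduct_smul, pinv_dotProduct hW, if_neg (Ne.symm hm), smul_zero]
  · simp

lemma measurable_pinv {ι : Type*} [Fintype ι] [DecidableEq ι] {n : ℕ} (l : ι) (j : Fin n) :
    Measurable fun W : ι → Fin n → ℝ => pinv W l j := by
  unfold pinv
  exact Finset.measurable_sum _ fun m _ => (measurable_inv_colGram l m).mul (by fun_prop)

lemma memLp_pinv {ι : Type*} [Fintype ι] [DecidableEq ι] {n : ℕ}
    (hd : Fintype.card ι + 1 < n) (l : ι) (j : Fin n) :
    MemLp (fun W => pinv W l j) 2 (Measure.pi fun _ : ι => gaussVec n) := by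
  rw [memLp_two_iff_integrable_sq (measurable_pinv l j).aestronglyMeasurable]
  refine (integrable_inv_colGram hd l).mono' ((measurable_pinv l j).pow_const 2).aestronglyMeasurable ?_
  filter_upwards [ae_linearIndependent hd] with W hW
  rw [Real.norm_eq_abs, abs_of_nonneg (sq_nonneg _), ← pinv_dotProduct_self hW, dotProduct, sq]
  exact Finset.single_le_sum (f := fun i => pinv W l i * pinv W l i)
    (fun i _ => mul_self_nonneg _) (Finset.mem_univ j)

lemma sum_integral_pinv_sq {ι : Type*} [Fintype ι] [DecidableEq ι] {n : ℕ}
    (hd : Fintype.card ι + 1 < n) (l : ι) :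
    ∑ j, ∫ W, pinv W l j ^ 2 ∂(Measure.pi fun _ : ι => gaussVec n) =
      ((n : ℝ) - Fintype.card ι - 1)⁻¹ := by
  rw [← integral_inv_colGram hd l, ← integral_finsetSum _ fun j _ => (memLp_pinv hd l j).integrable_sq]
  refine integral_congr_ae ?_
  filter_upwards [ae_linearIndependent hd] with W hW
  rw [← pinv_dotProduct_self hW, dotProduct]
  simp only [sq]

/-! ### Orthogonal sums and product measures -/

section Orthogonal

variable {Ω Ω' ι : Type*} [MeasurableSpace Ω] [MeasurableSpace Ω'] [Fintype ι]
  {P : Measure Ω} {Q : Measure Ω'}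
  {ξ : ι → Ω → ℝ} {g : ι → Ω' → ℝ}

lemma memLp_two_mul_prod [IsFiniteMeasure P] [IsFiniteMeasure Q] {f : Ω → ℝ} {g : Ω' → ℝ}
    (hf : MemLp f 2 P) (hg : MemLp g 2 Q) :
    MemLp (fun z : Ω × Ω' => f z.1 * g z.2) 2 (P.prod Q) := by
  have hm : AEStronglyMeasurable (fun z : Ω × Ω' => f z.1 * g z.2) (P.prod Q) :=
    hf.1.comp_fst.mul hg.1.comp_snd
  rw [memLp_two_iff_integrable_sq hm]
  simp_rw [mul_pow]
  exact hf.integrable_sq.mul_prod hg.integrable_sq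

variable [IsProbabilityMeasure P] [IsProbabilityMeasure Q]

lemma memLp_sum_mul_prod (hξ : ∀ a, MemLp (ξ a) 2 P) (hg : ∀ a, MemLp (g a) 2 Q) :
    MemLp (fun z : Ω × Ω' => ∑ a, ξ a z.1 * g a z.2) 2 (P.prod Q) :=
  memLp_finsetSum _ fun a _ => memLp_two_mul_prod (hξ a) (hg a)

/-- Only the ξ need to be orthogonal; the g may be arbitrarily correlated. It serves twice: for
regression errors against rows of the pseudo-inverse, and for the consumer's covariates and noise
against coefficient errors. -/
lemma integral_sum_mul_sq [DecidableEq ι] {s : ι → ℝ} (hξ : ∀ a, MemLp (ξ a) 2 P)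
    (hg : ∀ a, MemLp (g a) 2 Q)
    (horth : ∀ a b, ∫ ω, ξ a ω * ξ b ω ∂P = if a = b then s a else 0) :
    ∫ z : Ω × Ω', (∑ a, ξ a z.1 * g a z.2) ^ 2 ∂(P.prod Q) = ∑ a, s a * ∫ ω, g a ω ^ 2 ∂Q := by
  have h1 : ∀ z : Ω × Ω', (∑ a, ξ a z.1 * g a z.2) ^ 2 =
      ∑ a, ∑ b, (ξ a z.1 * ξ b z.1) * (g a z.2 * g b z.2) := by
    intro z
    rw [sq, Finset.sum_mul_sum]
    exact Finset.sum_congr rfl fun a _ => Finset.sum_congr rfl fun b _ => by ring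
  have hint : ∀ a b, Integrable
      (fun z : Ω × Ω' => (ξ a z.1 * ξ b z.1) * (g a z.2 * g b z.2)) (P.prod Q) := fun a b =>
    ((hξ a).integrable_mul (hξ b)).mul_prod ((hg a).integrable_mul (hg b))
  simp_rw [h1]
  rw [integral_finsetSum _ fun a _ => integrable_finsetSum _ fun b _ => hint a b]
  refine Finset.sum_congr rfl fun a _ => ?_
  rw [integral_finsetSum _ fun b _ => hint a b, Finset.sum_eq_single a]
  · rw [integral_prod_mul (fun ω => ξ a ω * ξ a ω) (fun ω => g a ω * g a ω), horth, if_pos rfl]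
    simp only [sq]
  · intro b _ hb
    rw [integral_prod_mul (fun ω => ξ a ω * ξ b ω) (fun ω => g a ω * g b ω), horth,
      if_neg (Ne.symm hb), zero_mul]
  · simp

lemma integral_sum_mul_eq_zero (hξ : ∀ a, MemLp (ξ a) 2 P)
    (hg : ∀ a, MemLp (g a) 2 Q) (hzero : ∀ a, ∫ ω, ξ a ω ∂P = 0) :
    ∫ z : Ω × Ω', ∑ a, ξ a z.1 * g a z.2 ∂(P.prod Q) = 0 := by
  rw [integral_finsetSum _ fun a _ =>
    (memLp_two_mul_prod (hξ a) (hg a)).integrable (by norm_num)]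
  refine Finset.sum_eq_zero fun a _ => ?_
  rw [integral_prod_mul (ξ a) (g a), hzero, zero_mul]

end Orthogonal

/-! ### Moments of coordinates under product measures. -/

lemma integral_pi_mul_of_ne {ι : Type*} [Fintype ι] {α : ι → Type*} [∀ i, MeasurableSpace (α i)]
    {μ : ∀ i, Measure (α i)} [∀ i, IsProbabilityMeasure (μ i)] {i j : ι} (hij : i ≠ j)
    {f : α i → ℝ} {g : α j → ℝ} (hf : Measurable f) (hg : Measurable g) :
    ∫ x, f (x i) * g (x j) ∂(Measure.pi μ) = (∫ y, f y ∂(μ i)) * ∫ y, g y ∂(μ j) := by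
  have h1 : IndepFun (fun x : ∀ i, α i => f (x i)) (fun x => g (x j)) (Measure.pi μ) :=
    ((iIndepFun_pi (μ := μ) (X := fun i (y : α i) => y) fun i => aemeasurable_id).indepFun hij).comp hf hg
  have h2 := h1.integral_fun_mul_eq_mul_integral
    (hf.comp (measurable_pi_apply i)).aestronglyMeasurable
    (hg.comp (measurable_pi_apply j)).aestronglyMeasurable
  rw [h2]
  congr 1
  · exact integral_comp_eval (μ := μ) hf.aestronglyMeasurable
  · exact integral_comp_eval (μ := μ) hg.aestronglyMeasurable

lemma memLp_pi_eval {ι : Type*} [Fintype ι] {α : ι → Type*} [∀ i, MeasurableSpace (α i)]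
    {μ : ∀ i, Measure (α i)} [∀ i, IsProbabilityMeasure (μ i)] {i : ι} {f : α i → ℝ}
    (hf : MemLp f 2 (μ i)) : MemLp (fun x : ∀ i, α i => f (x i)) 2 (Measure.pi μ) :=
  hf.comp_measurePreserving (measurePreserving_eval μ i)

lemma memLp_id_gaussianReal_two (v : ℝ≥0) : MemLp (fun x : ℝ => x) 2 (gaussianReal 0 v) :=
  memLp_id_gaussianReal 2

lemma integral_sq_gaussianReal (v : ℝ≥0) : ∫ x, x * x ∂(gaussianReal 0 v) = v := by
  have h := variance_fun_id_gaussianReal (μ := 0) (v := v)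
  rw [variance_of_integral_eq_zero (by fun_prop) (by simp)] at h
  simpa [sq] using h

lemma integral_pi_gaussian_mul {ι : Type*} [Fintype ι] [DecidableEq ι] (v : ℝ≥0) (i j : ι) :
    ∫ x, x i * x j ∂(Measure.pi fun _ : ι => gaussianReal 0 v) = if i = j then (v : ℝ) else 0 := by
  split_ifs with h
  · subst h
    rw [integral_comp_eval (μ := fun _ : ι => gaussianReal 0 v) (i := i) (f := fun y => y * y)
      (by fun_prop), integral_sq_gaussianReal]
  · rw [integral_pi_mul_of_ne (μ := fun _ : ι => gaussianReal 0 v) h (f := fun y => y) (g := fun y => y)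
      measurable_id measurable_id]
    simp

lemma integral_pi_gaussian (v : ℝ≥0) {ι : Type*} [Fintype ι] (i : ι) :
    ∫ x, x i ∂(Measure.pi fun _ : ι => gaussianReal 0 v) = 0 := by
  rw [integral_comp_eval (μ := fun _ : ι => gaussianReal 0 v) (i := i) (f := fun y => y)
      (by fun_prop)]
  simp

/-- Data come as independent rows, but the Gram matrix argument conditions on columns. The two laws
are compared on boxes, where the measures are the same double product. -/
lemma measurePreserving_transpose (k n : ℕ) :
    MeasurePreserving (fun (X : Fin n → Fin k → ℝ) (l : Fin k) (j : Fin n) => X j l)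
      (Measure.pi fun _ : Fin n => gaussVec k) (Measure.pi fun _ : Fin k => gaussVec n) := by
  refine ⟨by fun_prop, ?_⟩
  symm
  refine Measure.pi_eq_generateFrom
    (C := fun _ => Set.pi Set.univ '' Set.pi Set.univ fun _ : Fin n => {s : Set ℝ | MeasurableSet s})
    (fun _ => generateFrom_pi) (fun _ => isPiSystem_pi)
    (fun _ => ?_) ?_
  · exact Measure.FiniteSpanningSetsIn.pi fun _ =>
      (gaussianReal 0 1).toFiniteSpanningSetsIn
  · intro s hs
    choose t ht hts using hs
    obtain rfl : s = fun l => Set.univ.pi (t l) := funext fun l => (hts l).symm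
    have hpre : (fun (X : Fin n → Fin k → ℝ) (l : Fin k) (j : Fin n) => X j l) ⁻¹'
        (Set.univ.pi fun l => Set.univ.pi (t l)) =
        Set.univ.pi fun j => Set.univ.pi fun l => t l j := by
      ext X
      simp only [Set.mem_preimage, Set.mem_univ_pi]
      exact forall_comm
    rw [Measure.map_apply (by fun_prop), hpre]
    · simp_rw [Measure.pi_pi]
      exact Finset.prod_comm
    · exact MeasurableSet.univ_pi fun l => MeasurableSet.univ_pi fun j => ht l j (Set.mem_univ _)

/-! ### Moments of the OLS estimator given the coefficients -/

section Draws

variable {k n : ℕ} {v : ℝ≥0} {M : Finset (Fin k)}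

instance : IsProbabilityMeasure (drawLaw k n v) := by unfold drawLaw; infer_instance

/-- The columns of the covariate matrix that belong to the model. -/
def modelCols (M : Finset (Fin k)) (X : Fin n → Fin k → ℝ) : M → Fin n → ℝ := fun l j => X j l

/-- The part of a draw that a model leaves out: the other covariates and the noise. -/
abbrev Omitted (n : ℕ) (M : Finset (Fin k)) : Type :=
  ({l // l ∉ M} → Fin n → ℝ) × (Fin n → ℝ)

/-- The law of the omitted part. -/
def omittedLaw (n : ℕ) (v : ℝ≥0) (M : Finset (Fin k)) : Measure (Omitted n M) :=
  (Measure.pi fun _ : {l // l ∉ M} => gaussVec n).prod (Measure.pi fun _ : Fin n => gaussianReal 0 v)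

instance : IsProbabilityMeasure (omittedLaw n v M) := by unfold omittedLaw; infer_instance

/-- A draw split into the omitted part and the model covariates. -/
def splitDraw (M : Finset (Fin k)) (D : Draw k n) : Omitted n M × (M → Fin n → ℝ) :=
  ((fun l j => D.1 j l, D.2), modelCols M D.1)

lemma measurePreserving_splitDraw (M : Finset (Fin k)) :
    MeasurePreserving (splitDraw M) (drawLaw k n v)
      ((omittedLaw n v M).prod (Measure.pi fun _ : M => gaussVec n)) := by
  have h1 := (measurePreserving_transpose k n).prod
    (MeasurePreserving.id (Measure.pi fun _ : Fin n => gaussianReal 0 v))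
  have h0 := measurePreserving_piEquivPiSubtypeProd (fun _ : Fin k => gaussVec n) (· ∈ M)
  -- The product measures carry two different `Fintype` structures on the model, identified here.
  rw [Subsingleton.elim (Subtype.fintype (· ∈ M)) (Finset.Subtype.fintype M)] at h0
  have h2 := h0.prod (MeasurePreserving.id (Measure.pi fun _ : Fin n => gaussianReal 0 v))
  have h3 := measurePreserving_prodAssoc (Measure.pi fun _ : {l // l ∈ M} => gaussVec n)
    (Measure.pi fun _ : {l // l ∉ M} => gaussVec n) (Measure.pi fun _ : Fin n => gaussianReal 0 v)
  exact (Measure.measurePreserving_swap.comp (h3.comp (h2.comp h1)))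

/-- The regression error caused by the omitted covariates and the noise. -/
def omittedError (M : Finset (Fin k)) (β : Fin k → ℝ) (j : Fin n) (R : Omitted n M) : ℝ :=
  ∑ l : {l // l ∉ M}, β l * R.1 l j + R.2 j

lemma memLp_omitted_cov (l : {l // l ∉ M}) (j : Fin n) :
    MemLp (fun C : {l // l ∉ M} → Fin n → ℝ => C l j) 2
      (Measure.pi fun _ : {l // l ∉ M} => gaussVec n) :=
  memLp_pi_eval (μ := fun _ : {l // l ∉ M} => gaussVec n) (i := l) (f := fun x => x j)
    (memLp_pi_eval (μ := fun _ : Fin n => gaussianReal 0 1) (f := fun x => x)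
      (memLp_id_gaussianReal_two 1))

lemma memLp_noise (j : Fin n) :
    MemLp (fun η : Fin n → ℝ => η j) 2 (Measure.pi fun _ : Fin n => gaussianReal 0 v) :=
  memLp_pi_eval (μ := fun _ : Fin n => gaussianReal 0 v) (f := fun x => x)
      (memLp_id_gaussianReal_two v)

lemma memLp_omitted_sum (β : Fin k → ℝ) (j : Fin n) :
    MemLp (fun C : {l // l ∉ M} → Fin n → ℝ => ∑ l : {l // l ∉ M}, β l * C l j) 2
      (Measure.pi fun _ : {l // l ∉ M} => gaussVec n) :=
  memLp_finsetSum _ fun l _ => (memLp_omitted_cov l j).const_mul (β l)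

lemma memLp_omittedError (β : Fin k → ℝ) (j : Fin n) :
    MemLp (omittedError M β j) 2 (omittedLaw n v M) :=
  ((memLp_omitted_sum β j).comp_fst _).add ((memLp_noise j).comp_snd _)

lemma integral_omitted_cov_mul (l m : {l // l ∉ M}) (i j : Fin n) :
    ∫ C, C l i * C m j ∂(Measure.pi fun _ : {l // l ∉ M} => gaussVec n) =
      if l = m then (if i = j then 1 else 0) else 0 := by
  split_ifs with h h'
  · subst h h'
    rw [integral_comp_eval (μ := fun _ : {l // l ∉ M} => gaussVec n) (i := l)
      (f := fun x : Fin n → ℝ => x i * x i) (by fun_prop), integral_pi_gaussian_mul]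
    simp
  · subst h
    rw [integral_comp_eval (μ := fun _ : {l // l ∉ M} => gaussVec n) (i := l)
      (f := fun x : Fin n → ℝ => x i * x j) (by fun_prop), integral_pi_gaussian_mul, if_neg h']
  · rw [integral_pi_mul_of_ne (μ := fun _ : {l // l ∉ M} => gaussVec n) h
      (f := fun x : Fin n → ℝ => x i) (g := fun x : Fin n → ℝ => x j) (by fun_prop) (by fun_prop),
      integral_pi_gaussian, zero_mul]

lemma integral_omitted_sum (β : Fin k → ℝ) (j : Fin n) :
    ∫ C, ∑ l : {l // l ∉ M}, β l * C l j ∂(Measure.pi fun _ : {l // l ∉ M} => gaussVec n) = 0 := by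
  rw [integral_finsetSum _ fun l _ => ((memLp_omitted_cov l j).integrable (by norm_num)).const_mul _]
  refine Finset.sum_eq_zero fun l _ => ?_
  rw [integral_const_mul, integral_comp_eval (μ := fun _ : {l // l ∉ M} => gaussVec n) (i := l)
      (f := fun x : Fin n → ℝ => x j) (measurable_pi_apply j).aestronglyMeasurable,
      integral_pi_gaussian, mul_zero]

lemma integral_omitted_sum_mul (β : Fin k → ℝ) (i j : Fin n) :
    ∫ C, (∑ l : {l // l ∉ M}, β l * C l i) * (∑ l : {l // l ∉ M}, β l * C l j)
        ∂(Measure.pi fun _ : {l // l ∉ M} => gaussVec n) =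
      if i = j then ∑ l : {l // l ∉ M}, β l ^ 2 else 0 := by
  have h1 : ∀ C : {l // l ∉ M} → Fin n → ℝ,
      (∑ l : {l // l ∉ M}, β l * C l i) * (∑ l : {l // l ∉ M}, β l * C l j) =
      ∑ l : {l // l ∉ M}, ∑ m : {l // l ∉ M}, (β l * β m) * (C l i * C m j) := by
    intro C
    rw [Finset.sum_mul_sum]
    exact Finset.sum_congr rfl fun a _ => Finset.sum_congr rfl fun b _ => by ring
  have hint : ∀ l m : {l // l ∉ M}, Integrable
      (fun C : {l // l ∉ M} → Fin n → ℝ => (β l * β m) * (C l i * C m j))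
      (Measure.pi fun _ : {l // l ∉ M} => gaussVec n) := fun l m =>
    ((memLp_omitted_cov l i).integrable_mul (memLp_omitted_cov m j)).const_mul _
  simp_rw [h1]
  rw [integral_finsetSum _ fun l _ => integrable_finsetSum _ fun m _ => hint l m]
  have h2 : ∀ l : {l // l ∉ M}, ∫ C, ∑ m : {l // l ∉ M}, (β l * β m) * (C l i * C m j)
      ∂(Measure.pi fun _ : {l // l ∉ M} => gaussVec n) = if i = j then β l ^ 2 else 0 := by
    intro l
    rw [integral_finsetSum _ fun m _ => hint l m]
    simp_rw [integral_const_mul, integral_omitted_cov_mul]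
    simp [sq]
  simp_rw [h2]
  split_ifs <;> simp

/-- The variance of the regression error, given the coefficients. -/
def omittedVar (v : ℝ≥0) (M : Finset (Fin k)) (β : Fin k → ℝ) : ℝ :=
  ∑ l : {l // l ∉ M}, β l ^ 2 + v

lemma integral_omittedError (β : Fin k → ℝ) (j : Fin n) :
    ∫ R, omittedError M β j R ∂(omittedLaw n v M) = 0 := by
  unfold omittedError omittedLaw
  rw [integral_add (((memLp_omitted_sum β j).integrable (by norm_num)).comp_fst _)
    (((memLp_noise j).integrable (by norm_num)).comp_snd _)]
  rw [integral_fun_fst (fun C : {l // l ∉ M} → Fin n → ℝ => ∑ l : {l // l ∉ M}, β l * C l j),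
    integral_fun_snd (fun η : Fin n → ℝ => η j), integral_omitted_sum, integral_pi_gaussian]
  simp

/-- Omitted covariates and noise are independent and centred, so the mixed products vanish; distinct
observations are uncorrelated in each part. -/
lemma integral_omittedError_mul (β : Fin k → ℝ) (i j : Fin n) :
    ∫ R, omittedError M β i R * omittedError M β j R ∂(omittedLaw n v M) =
      if i = j then omittedVar v M β else 0 := by
  have hU : ∀ j, MemLp (fun R : Omitted n M => ∑ l : {l // l ∉ M}, β l * R.1 l j) 2
    (omittedLaw n v M) := fun j => (memLp_omitted_sum β j).comp_fst _
  have hE : ∀ j, MemLp (fun R : Omitted n M => R.2 j) 2 (omittedLaw n v M) :=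
    fun j => (memLp_noise j).comp_snd _
  have e1 := (hU i).integrable_mul (hU j)
  have e2 := (hE i).integrable_mul (hE j)
  have e3 := (hU i).integrable_mul (hE j)
  have e4 := (hU j).integrable_mul (hE i)
  have h1 : (fun R : Omitted n M => omittedError M β i R * omittedError M β j R) = fun R =>
      ((∑ l : {l // l ∉ M}, β l * R.1 l i) * (∑ l : {l // l ∉ M}, β l * R.1 l j) + R.2 i * R.2 j) +
      ((∑ l : {l // l ∉ M}, β l * R.1 l i) * R.2 j + (∑ l : {l // l ∉ M}, β l * R.1 l j) * R.2 i) := by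
    ext R
    unfold omittedError
    ring
  rw [h1]
  refine (integral_add (e1.add e2) (e3.add e4)).trans ?_
  rw [integral_add' e1 e2, integral_add' e3 e4]
  simp only [Pi.mul_apply]
  unfold omittedLaw
  rw [integral_fun_fst (fun C : {l // l ∉ M} → Fin n → ℝ =>
      (∑ l : {l // l ∉ M}, β l * C l i) * (∑ l : {l // l ∉ M}, β l * C l j)),
    integral_fun_snd (fun η : Fin n → ℝ => η i * η j),
    integral_prod_mul (fun C : {l // l ∉ M} → Fin n → ℝ => ∑ l : {l // l ∉ M}, β l * C l i)
      (fun η : Fin n → ℝ => η j),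
    integral_prod_mul (fun C : {l // l ∉ M} → Fin n → ℝ => ∑ l : {l // l ∉ M}, β l * C l j)
      (fun η : Fin n → ℝ => η i),
    integral_omitted_sum_mul, integral_omitted_sum, integral_omitted_sum, integral_pi_gaussian_mul]
  split_ifs <;> simp [omittedVar]

lemma subCov_gram (M : Finset (Fin k)) (X : Fin n → Fin k → ℝ) :
    (subCov M X)ᵀ * subCov M X = colGram (modelCols M X) := by
  ext l m
  simp [subCov, colGram, modelCols, Matrix.mul_apply, dotProduct]

lemma betaHat_eq_pinv (β : Fin k → ℝ) (D : Draw k n) (l : Fin k) (hl : l ∈ M) :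
    betaHat M β D l = pinv (modelCols M D.1) ⟨l, hl⟩ ⬝ᵥ outcomes β D := by
  rw [betaHat, ols, dif_pos hl, subCov_gram]
  simp only [Matrix.mulVec, dotProduct, pinv, Matrix.transpose_apply, subCov, Matrix.of_apply,
    Finset.mul_sum, Finset.sum_mul]
  rw [Finset.sum_comm]
  refine Finset.sum_congr rfl fun j _ => Finset.sum_congr rfl fun m _ => ?_
  simp only [modelCols]
  ring

lemma betaHat_of_notMem (β : Fin k → ℝ) (D : Draw k n) {l : Fin k} (hl : l ∉ M) :
    betaHat M β D l = 0 := by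
  rw [betaHat, ols, dif_neg hl]

lemma outcomes_eq (β : Fin k → ℝ) (D : Draw k n) :
    outcomes β D = ∑ m : M, β m • modelCols M D.1 m +
      fun j => omittedError M β j (splitDraw M D).1 := by
  ext j
  simp only [outcomes, omittedError, splitDraw, modelCols, dotProduct, Pi.add_apply,
    Finset.sum_apply, Pi.smul_apply, smul_eq_mul]
  rw [← add_assoc]
  congr 1
  rw [← Fintype.sum_subtype_add_sum_subtype (fun l => l ∈ M) (fun l => D.1 j l * β l)]
  congr 1 <;> exact Finset.sum_congr (Finset.ext fun _ => by simp) fun l _ => mul_comm _ _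

/-- The pseudo-inverse reproduces the coefficients in M exactly; only its action on the omitted
error remains. -/
lemma betaHat_sub_eq (β : Fin k → ℝ) {D : Draw k n} (hD : LinearIndependent ℝ (modelCols M D.1))
    {l : Fin k} (hl : l ∈ M) :
    betaHat M β D l - β l = ∑ j, omittedError M β j (splitDraw M D).1 *
      pinv (splitDraw M D).2 ⟨l, hl⟩ j := by
  rw [betaHat_eq_pinv β D l hl, outcomes_eq (M := M), dotProduct_add, dotProduct_sum,
    Finset.sum_eq_single ⟨l, hl⟩]
  · rw [dotProduct_smul, pinv_dotProduct hD, if_pos rfl]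
    simp only [smul_eq_mul, mul_one, add_sub_cancel_left, dotProduct, splitDraw]
    exact Finset.sum_congr rfl fun j _ => mul_comm _ _
  · intro m _ hm
    rw [dotProduct_smul, pinv_dotProduct hD, if_neg (Ne.symm hm), smul_zero]
  · simp

lemma measurable_betaHat (l : Fin k) :
    Measurable fun q : (Fin k → ℝ) × Draw k n => betaHat M q.1 q.2 l := by
  by_cases hl : l ∈ M
  · simp_rw [betaHat_eq_pinv _ _ l hl, dotProduct, outcomes, dotProduct]
    refine Finset.measurable_sum _ fun j _ => Measurable.mul ?_ (by fun_prop)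
    refine (measurable_pinv _ j).comp ?_
    unfold modelCols
    fun_prop
  · simp_rw [betaHat_of_notMem _ _ hl]
    exact measurable_const

attribute [local irreducible] betaHat pinv

lemma measurable_betaHat_draw (β : Fin k → ℝ) (l : Fin k) :
    Measurable fun D : Draw k n => betaHat M β D l :=
  (measurable_betaHat (M := M) l).comp (measurable_prodMk_left (x := β))

lemma ae_betaHat_sub_eq (hM : M.card + 1 < n) (β : Fin k → ℝ) {l : Fin k} (hl : l ∈ M) :
    (fun D => betaHat M β D l - β l) =ᵐ[drawLaw k n v]
      (fun q => ∑ j, omittedError M β j q.1 * pinv q.2 ⟨l, hl⟩ j) ∘ splitDraw M := by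
  have hli := ae_linearIndependent (ι := M) (n := n) (by simpa using hM)
  have h2 : ∀ᵐ q ∂((omittedLaw n v M).prod (Measure.pi fun _ : M => gaussVec n)),
      LinearIndependent ℝ q.2 := Measure.quasiMeasurePreserving_snd.ae hli
  filter_upwards [(measurePreserving_splitDraw M).quasiMeasurePreserving.ae h2] with D hD
  exact betaHat_sub_eq β hD hl

lemma memLp_betaHat_sub (hM : M.card + 1 < n) (β : Fin k → ℝ) {l : Fin k} (hl : l ∈ M) :
    MemLp (fun D => betaHat M β D l - β l) 2 (drawLaw k n v) := by
  rw [memLp_congr_ae (ae_betaHat_sub_eq hM β hl)]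
  exact (memLp_sum_mul_prod (fun j => memLp_omittedError β j)
    (fun j => memLp_pinv (ι := M) (n := n) (by simpa using hM) ⟨l, hl⟩ j)).comp_measurePreserving
    (measurePreserving_splitDraw M)

lemma memLp_betaHat (hM : M.card + 1 < n) (β : Fin k → ℝ) (l : Fin k) :
    MemLp (fun D => betaHat M β D l) 2 (drawLaw k n v) := by
  by_cases hl : l ∈ M
  · have h := (memLp_betaHat_sub (v := v) hM β hl).add (memLp_const (β l))
    refine h.congr_norm (measurable_betaHat_draw β l).aestronglyMeasurable (ae_of_all _ fun D => ?_)
    simp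
  · simp_rw [betaHat_of_notMem _ _ hl]
    exact memLp_const 0

lemma integral_comp_splitDraw {f : Omitted n M × (M → Fin n → ℝ) → ℝ}
    (hf : AEStronglyMeasurable f ((omittedLaw n v M).prod (Measure.pi fun _ : M => gaussVec n))) :
    ∫ D, f (splitDraw M D) ∂(drawLaw k n v) =
      ∫ q, f q ∂((omittedLaw n v M).prod (Measure.pi fun _ : M => gaussVec n)) := by
  have h := measurePreserving_splitDraw (n := n) (v := v) M
  rw [← h.map_eq] at hf ⊢
  rw [integral_map h.measurable.aemeasurable hf]

lemma meanBetaHat_eq (hM : M.card + 1 < n) (β : Fin k → ℝ) (l : Fin k) :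
    meanBetaHat n v M β l = if l ∈ M then β l else 0 := by
  unfold meanBetaHat
  split_ifs with hl
  · have h0 : ∫ D, (betaHat M β D l - β l) ∂(drawLaw k n v) = 0 := by
      have hp : ∀ j, MemLp (fun W : M → Fin n → ℝ => pinv W ⟨l, hl⟩ j) 2
        (Measure.pi fun _ : M => gaussVec n) := fun j => memLp_pinv (ι := M) (n := n) (by simpa using hM) ⟨l, hl⟩ j
      have hmem := memLp_sum_mul_prod
        (fun j => memLp_omittedError (v := v) (M := M) (n := n) β j) hp
      rw [integral_congr_ae (ae_betaHat_sub_eq hM β hl)]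
      simp only [Function.comp_apply]
      rw [integral_comp_splitDraw hmem.1]
      exact integral_sum_mul_eq_zero (fun j => memLp_omittedError (v := v) β j)
        hp fun j => integral_omittedError β j
    rw [integral_sub ((memLp_betaHat hM β l).integrable (by norm_num)) (integrable_const _)] at h0
    simpa [sub_eq_zero] using h0
  · simp_rw [betaHat_of_notMem _ _ hl]
    simp

lemma integral_betaHat_sub_sq (hM : M.card + 1 < n) (β : Fin k → ℝ) {l : Fin k} (hl : l ∈ M) :
    ∫ D, (betaHat M β D l - β l) ^ 2 ∂(drawLaw k n v) =
      omittedVar v M β * ((n : ℝ) - M.card - 1)⁻¹ := by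
  have hp : ∀ j, MemLp (fun W : M → Fin n → ℝ => pinv W ⟨l, hl⟩ j) 2
      (Measure.pi fun _ : M => gaussVec n) := fun j => memLp_pinv (ι := M) (n := n) (by simpa using hM) ⟨l, hl⟩ j
  have hmem := memLp_sum_mul_prod
    (fun j => memLp_omittedError (v := v) (M := M) (n := n) β j) hp
  have h1 : (fun D => (betaHat M β D l - β l) ^ 2) =ᵐ[drawLaw k n v]
      fun D => (fun q : Omitted n M × (M → Fin n → ℝ) =>
        (∑ j, omittedError M β j q.1 * pinv q.2 ⟨l, hl⟩ j) ^ 2) (splitDraw M D) := by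
    filter_upwards [ae_betaHat_sub_eq (v := v) hM β hl] with D hD
    rw [hD]
    rfl
  refine (integral_congr_ae h1).trans ((integral_comp_splitDraw (hmem.1.pow 2)).trans ?_)
  refine (integral_sum_mul_sq (s := fun _ => omittedVar v M β)
    (fun j => memLp_omittedError (v := v) β j) hp
    fun i j => integral_omittedError_mul β i j).trans ?_
  rw [← Finset.mul_sum, sum_integral_pinv_sq (by simpa using hM)]
  simp

end Draws

/-! ### Moments of the prediction error -/

attribute [local irreducible] betaHat

section Errors

variable {k n : ℕ} {F : Measure ℝ} {v : ℝ≥0} {M M' : Finset (Fin k)}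

/-- Joint law of the coefficients and the two datasets. -/
def trainLaw (k n : ℕ) (F : Measure ℝ) (v : ℝ≥0) : Measure ((Fin k → ℝ) × (Fin 2 → Draw k n)) :=
  (Measure.pi fun _ : Fin k => F).prod (Measure.pi fun _ : Fin 2 => drawLaw k n v)

/-- Joint law of the consumer's covariates and noise. -/
def queryLaw (k : ℕ) (v : ℝ≥0) : Measure ((Fin k → ℝ) × ℝ) := (gaussVec k).prod (gaussianReal 0 v)

instance : IsProbabilityMeasure (queryLaw k v) := by unfold queryLaw; infer_instance

instance [IsProbabilityMeasure F] : IsProbabilityMeasure (trainLaw k n F v) := by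
  unfold trainLaw; infer_instance

lemma measurePreserving_query_train [IsProbabilityMeasure F] :
    MeasurePreserving (fun s : Sample k n => (s.2.1, (s.1, s.2.2))) (sampleLaw k n F v)
      ((queryLaw k v).prod (trainLaw k n F v)) := by
  have h1 := (measurePreserving_prodAssoc (Measure.pi fun _ : Fin k => F) (queryLaw k v)
    (Measure.pi fun _ : Fin 2 => drawLaw k n v)).symm
  have h2 := (Measure.measurePreserving_swap (μ := Measure.pi fun _ : Fin k => F)
    (ν := queryLaw k v)).prod (MeasurePreserving.id (Measure.pi fun _ : Fin 2 => drawLaw k n v))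
  have h3 := measurePreserving_prodAssoc (queryLaw k v) (Measure.pi fun _ : Fin k => F)
    (Measure.pi fun _ : Fin 2 => drawLaw k n v)
  exact h3.comp (h2.comp h1)

/-- The consumer's noise (at `none`) and covariates. -/
def queryCoord (a : Option (Fin k)) (q : (Fin k → ℝ) × ℝ) : ℝ := a.elim q.2 q.1

lemma memLp_queryCoord (a : Option (Fin k)) : MemLp (queryCoord a) 2 (queryLaw k v) := by
  cases a with
  | none => exact (memLp_id_gaussianReal_two v).comp_snd _
  | some l => exact (memLp_pi_eval (μ := fun _ : Fin k => gaussianReal 0 1) (i := l)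
      (f := fun x => x) (memLp_id_gaussianReal_two 1)).comp_fst _

lemma integral_queryCoord_mul (a b : Option (Fin k)) :
    ∫ q, queryCoord a q * queryCoord b q ∂(queryLaw k v) =
      if a = b then a.elim (v : ℝ) (fun _ => 1) else 0 := by
  unfold queryLaw queryCoord
  cases a with
  | none =>
    cases b with
    | none =>
      simp only [Option.elim_none, if_true]
      rw [integral_fun_snd (fun x : ℝ => x * x), integral_sq_gaussianReal]
      simp
    | some m =>
      simp only [Option.elim_none, Option.elim_some, reduceCtorEq, if_false]
      simp_rw [fun q : (Fin k → ℝ) × ℝ => mul_comm q.2 (q.1 m)]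
      rw [integral_prod_mul (fun x : Fin k → ℝ => x m) (fun y : ℝ => y), integral_pi_gaussian, zero_mul]
  | some l =>
    cases b with
    | none =>
      simp only [Option.elim_none, Option.elim_some, reduceCtorEq, if_false]
      rw [integral_prod_mul (fun x : Fin k → ℝ => x l) (fun y : ℝ => y), integral_pi_gaussian, zero_mul]
    | some m =>
      simp only [Option.elim_some, Option.some.injEq]
      rw [integral_fun_fst (fun x : Fin k → ℝ => x l * x m), integral_pi_gaussian_mul]
      simp

/-- The mean square of `xᵀ g(β, D) + a ε`. -/
lemma integral_query_sq [IsProbabilityMeasure F]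
    {g : Fin k → (Fin k → ℝ) × (Fin 2 → Draw k n) → ℝ}
    (hg : ∀ l, MemLp (g l) 2 (trainLaw k n F v)) (a : ℝ) :
    Integrable (fun s : Sample k n =>
        (s.2.1.1 ⬝ᵥ (fun l => g l (s.1, s.2.2)) + a * s.2.1.2) ^ 2) (sampleLaw k n F v) ∧
      ∫ s : Sample k n, (s.2.1.1 ⬝ᵥ (fun l => g l (s.1, s.2.2)) + a * s.2.1.2) ^ 2
        ∂(sampleLaw k n F v) = ∑ l, ∫ q, g l q ^ 2 ∂(trainLaw k n F v) + a ^ 2 * v := by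
  -- An extra coordinate carries the noise with constant coefficient a: a = 1 for the prediction
  -- error, a = 0 for its bias and variance parts.
  set G : Option (Fin k) → (Fin k → ℝ) × (Fin 2 → Draw k n) → ℝ :=
    fun o => o.elim (fun _ => a) g with hG
  have hGm : ∀ o, MemLp (G o) 2 (trainLaw k n F v) := by
    intro o
    cases o with
    | none => exact memLp_const a
    | some l => exact hg l
  have hmem := memLp_sum_mul_prod (fun o => memLp_queryCoord (v := v) o) hGm
  have hmp := measurePreserving_query_train (k := k) (n := n) (F := F) (v := v)
  have heq : (fun s : Sample k n => (s.2.1.1 ⬝ᵥ (fun l => g l (s.1, s.2.2)) + a * s.2.1.2) ^ 2) =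
      (fun z : ((Fin k → ℝ) × ℝ) × ((Fin k → ℝ) × (Fin 2 → Draw k n)) =>
        (∑ o, queryCoord o z.1 * G o z.2) ^ 2) ∘ fun s : Sample k n => (s.2.1, (s.1, s.2.2)) := by
    ext s
    simp only [Function.comp_apply, Fintype.sum_option, hG, queryCoord, Option.elim_none,
      Option.elim_some, dotProduct]
    ring
  rw [heq]
  refine ⟨hmp.integrable_comp_of_integrable hmem.integrable_sq, ?_⟩
  have h1 := integral_sum_mul_sq (s := fun o : Option (Fin k) => o.elim (v : ℝ) (fun _ => 1))
    (fun o => memLp_queryCoord (v := v) o) hGm fun o o' => integral_queryCoord_mul o o'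
  rw [← hmp.map_eq] at h1 hmem
  refine (integral_map hmp.measurable.aemeasurable (hmem.1.pow 2)).symm.trans (h1.trans ?_)
  simp only [Fintype.sum_option, hG, Option.elim_none, Option.elim_some, one_mul, integral_const,
    probReal_univ, smul_eq_mul]
  ring

lemma memLp_coef [IsProbabilityMeasure F] (hF : MemLp id 2 F) (l : Fin k) :
    MemLp (fun β : Fin k → ℝ => β l) 2 (Measure.pi fun _ : Fin k => F) :=
  memLp_pi_eval (μ := fun _ : Fin k => F) (f := fun x => x) hF

lemma integral_coef_sq [IsProbabilityMeasure F] (l : Fin k) :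
    ∫ β, β l ^ 2 ∂(Measure.pi fun _ : Fin k => F) = secondMoment F :=
  integral_comp_eval (μ := fun _ : Fin k => F) (i := l) (f := fun x => x ^ 2) (by fun_prop)

lemma card_omitted (M : Finset (Fin k)) : (Fintype.card {l // l ∉ M} : ℝ) = k - M.card := by
  rw [Fintype.card_subtype_compl, Nat.cast_sub]
  · simp
  · exact Fintype.card_subtype_le _

lemma integrable_omittedVar [IsProbabilityMeasure F] (hF : MemLp id 2 F) :
    Integrable (omittedVar v M) (Measure.pi fun _ : Fin k => F) := by
  unfold omittedVar
  exact (integrable_finsetSum _ fun l _ => (memLp_coef hF l.1).integrable_sq).add (integrable_const _)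

lemma integral_omittedVar [IsProbabilityMeasure F] (hF : MemLp id 2 F) :
    ∫ β, omittedVar v M β ∂(Measure.pi fun _ : Fin k => F) =
      secondMoment F * ((k : ℝ) - M.card) + v := by
  unfold omittedVar
  rw [integral_add (integrable_finsetSum _ fun l _ => (memLp_coef hF l.1).integrable_sq)
    (integrable_const _), integral_finsetSum _ fun l _ => (memLp_coef hF l.1).integrable_sq]
  simp_rw [integral_coef_sq]
  rw [Finset.sum_const, Finset.card_univ, nsmul_eq_mul, card_omitted]
  simp [mul_comm]

lemma memLp_coef_train [IsProbabilityMeasure F] (hF : MemLp id 2 F) (l : Fin k) :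
    MemLp (fun q : (Fin k → ℝ) × (Fin 2 → Draw k n) => q.1 l) 2 (trainLaw k n F v) :=
  (memLp_coef hF l).comp_fst _

lemma measurable_betaHat_train (M : Finset (Fin k)) (i : Fin 2) (l : Fin k) :
    Measurable fun q : (Fin k → ℝ) × (Fin 2 → Draw k n) => betaHat M q.1 (q.2 i) l :=
  (measurable_betaHat (M := M) l).comp
    (measurable_fst.prodMk ((measurable_pi_apply i).comp measurable_snd))

/-- The conditional moment given β is linear in `omittedVar`, which is integrable in β, so Fubini
applies. -/
lemma betaHat_dev_train [IsProbabilityMeasure F] (hF : MemLp id 2 F) (hM : M.card + 1 < n)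
    (i : Fin 2) {l : Fin k} (hl : l ∈ M) :
    MemLp (fun q : (Fin k → ℝ) × (Fin 2 → Draw k n) => betaHat M q.1 (q.2 i) l - q.1 l) 2
        (trainLaw k n F v) ∧
      ∫ q, (betaHat M q.1 (q.2 i) l - q.1 l) ^ 2 ∂(trainLaw k n F v) =
        (secondMoment F * ((k : ℝ) - M.card) + v) * ((n : ℝ) - M.card - 1)⁻¹ := by
  have hmeas : Measurable
      fun q : (Fin k → ℝ) × (Fin 2 → Draw k n) => betaHat M q.1 (q.2 i) l - q.1 l :=
    (measurable_betaHat_train M i l).sub (by fun_prop)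
  have hslice : ∀ β : Fin k → ℝ, Integrable (fun D : Fin 2 → Draw k n =>
      (betaHat M β (D i) l - β l) ^ 2) (Measure.pi fun _ : Fin 2 => drawLaw k n v) := fun β =>
    (memLp_pi_eval (μ := fun _ : Fin 2 => drawLaw k n v) (i := i)
      (f := fun D => betaHat M β D l - β l) (memLp_betaHat_sub hM β hl)).integrable_sq
  have hval : ∀ β : Fin k → ℝ, ∫ D : Fin 2 → Draw k n, (betaHat M β (D i) l - β l) ^ 2
      ∂(Measure.pi fun _ : Fin 2 => drawLaw k n v) =
      omittedVar v M β * ((n : ℝ) - M.card - 1)⁻¹ := by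
    intro β
    rw [← integral_betaHat_sub_sq hM β hl]
    exact integral_comp_eval (μ := fun _ : Fin 2 => drawLaw k n v) (i := i)
      (f := fun D => (betaHat M β D l - β l) ^ 2)
      (((measurable_betaHat_draw β l).sub_const _).pow_const 2).aestronglyMeasurable
  have hint : Integrable (fun q : (Fin k → ℝ) × (Fin 2 → Draw k n) =>
      (betaHat M q.1 (q.2 i) l - q.1 l) ^ 2) (trainLaw k n F v) := by
    unfold trainLaw
    rw [integrable_prod_iff (hmeas.pow_const 2).aestronglyMeasurable]
    refine ⟨ae_of_all _ hslice, ?_⟩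
    simp_rw [Real.norm_eq_abs, abs_sq, hval]
    exact (integrable_omittedVar hF).mul_const _
  refine ⟨(memLp_two_iff_integrable_sq hmeas.aestronglyMeasurable).2 hint, ?_⟩
  unfold trainLaw at hint ⊢
  rw [integral_prod _ hint]
  simp_rw [hval]
  rw [integral_mul_const, integral_omittedVar hF]

/-- The estimation error for the coefficient `l`. -/
def residual (M : Finset (Fin k)) (i : Fin 2) (l : Fin k)
    (q : (Fin k → ℝ) × (Fin 2 → Draw k n)) : ℝ := q.1 l - betaHat M q.1 (q.2 i) l

lemma memLp_residual [IsProbabilityMeasure F] (hF : MemLp id 2 F) (hM : M.card + 1 < n)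
    (i : Fin 2) (l : Fin k) : MemLp (residual M i l) 2 (trainLaw k n F v) := by
  by_cases hl : l ∈ M
  · refine (betaHat_dev_train (v := v) hF hM i hl).1.congr_norm
      (((measurable_pi_apply l).comp measurable_fst).sub
        (measurable_betaHat_train M i l)).aestronglyMeasurable (ae_of_all _ fun q => ?_)
    rw [residual, norm_sub_rev]
  · unfold residual
    simp_rw [betaHat_of_notMem _ _ hl, sub_zero]
    exact memLp_coef_train hF l

lemma integral_residual_sq [IsProbabilityMeasure F] (hF : MemLp id 2 F) (hM : M.card + 1 < n)
    (i : Fin 2) (l : Fin k) :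
    ∫ q, residual M i l q ^ 2 ∂(trainLaw k n F v) =
      if l ∈ M then (secondMoment F * ((k : ℝ) - M.card) + v) * ((n : ℝ) - M.card - 1)⁻¹
      else secondMoment F := by
  split_ifs with hl
  · rw [← (betaHat_dev_train (v := v) hF hM i hl).2]
    refine integral_congr_ae (ae_of_all _ fun q => ?_)
    simp only [residual]
    ring
  · unfold residual
    simp_rw [betaHat_of_notMem _ _ hl, sub_zero]
    unfold trainLaw
    rw [integral_fun_fst (fun β : Fin k → ℝ => β l ^ 2), integral_coef_sq]
    simp

/-- Given β the two residuals are independent, with conditional mean 0 inside the respective model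
and β_l outside it. -/
lemma integral_residual_mul [IsProbabilityMeasure F] (hF : MemLp id 2 F) (hM : M.card + 1 < n)
    (hM' : M'.card + 1 < n) (l : Fin k) :
    ∫ q, residual M 0 l q * residual M' 1 l q ∂(trainLaw k n F v) =
      if l ∈ M ∪ M' then 0 else secondMoment F := by
  have hint := (memLp_residual (v := v) hF hM 0 l).integrable_mul (memLp_residual hF hM' 1 l)
  unfold trainLaw at hint ⊢
  refine (integral_prod _ hint).trans ?_
  have hmean : ∀ (N : Finset (Fin k)), N.card + 1 < n → ∀ β : Fin k → ℝ,
      ∫ D, (β l - betaHat N β D l) ∂(drawLaw k n v) = if l ∈ N then 0 else β l := by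
    intro N hN β
    rw [integral_sub (integrable_const _) ((memLp_betaHat hN β l).integrable (by norm_num))]
    have := meanBetaHat_eq (v := v) hN β l
    rw [meanBetaHat] at this
    rw [this]
    split_ifs <;> simp
  have hslice : ∀ β : Fin k → ℝ, ∫ D : Fin 2 → Draw k n,
      (residual M 0 l (β, D) * residual M' 1 l (β, D)) ∂(Measure.pi fun _ : Fin 2 => drawLaw k n v) =
      if l ∈ M ∪ M' then 0 else β l ^ 2 := by
    intro β
    refine (integral_pi_mul_of_ne (μ := fun _ : Fin 2 => drawLaw k n v) (i := 0) (j := 1)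
      (by decide) (f := fun D => β l - betaHat M β D l) (g := fun D => β l - betaHat M' β D l)
      ((measurable_betaHat_draw β l).const_sub _)
      ((measurable_betaHat_draw β l).const_sub _)).trans ?_
    rw [hmean M hM, hmean M' hM']
    by_cases h1 : l ∈ M <;> by_cases h2 : l ∈ M' <;> simp [h1, h2, sq]
  refine (integral_congr_ae (ae_of_all _ hslice)).trans ?_
  split_ifs
  · simp
  · exact integral_coef_sq l

end Errors

/-! ### Bias, variance and the error of a weighted pair of models. -/

section PartOne

variable {k n : ℕ} {F : Measure ℝ} {v : ℝ≥0} {M M' : Finset (Fin k)}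

/-- The mean squared prediction error of OLS with `d` covariates. -/
def risk (k n : ℕ) (B v : ℝ) (d : ℕ) : ℝ :=
  v + B * ((k : ℝ) - d) + (B * ((k : ℝ) - d) + v) * ((d : ℝ) / ((n : ℝ) - d - 1))

lemma sum_ite_mem (M : Finset (Fin k)) (a b : ℝ) :
    ∑ l, (if l ∈ M then a else b) = M.card * a + ((k : ℝ) - M.card) * b := by
  rw [Finset.sum_ite, Finset.sum_const, Finset.sum_const, nsmul_eq_mul, nsmul_eq_mul,
    Finset.filter_mem_eq_inter, Finset.univ_inter, Finset.filter_notMem_eq_sdiff,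
    ← Finset.compl_eq_univ_sdiff, Finset.card_compl, Fintype.card_fin,
    Nat.cast_sub (by simpa using M.card_le_univ)]

lemma sqBias_moment [IsProbabilityMeasure F] (hF : MemLp id 2 F) (hM : M.card + 1 < n) :
    Integrable (sqBias (n := n) v M) (sampleLaw k n F v) ∧
      ∫ s, sqBias (n := n) v M s ∂(sampleLaw k n F v) =
        secondMoment F * ((k : ℝ) - M.card) := by
  have hg : ∀ l : Fin k, MemLp (fun q : (Fin k → ℝ) × (Fin 2 → Draw k n) =>
      if l ∈ M then 0 else q.1 l) 2 (trainLaw k n F v) := by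
    intro l
    split_ifs
    · exact memLp_const 0
    · exact memLp_coef_train hF l
  have h := integral_query_sq hg 0
  have heq : ∀ s : Sample k n, sqBias (n := n) v M s =
      (s.2.1.1 ⬝ᵥ (fun l => if l ∈ M then 0 else s.1 l) + 0 * s.2.1.2) ^ 2 := by
    intro s
    rw [sqBias, ← dotProduct_sub, zero_mul, add_zero]
    congr 2
    ext l
    rw [Pi.sub_apply, meanBetaHat_eq hM]
    split_ifs <;> simp
  have hsum : ∀ l : Fin k, ∫ q : (Fin k → ℝ) × (Fin 2 → Draw k n),
      (if l ∈ M then 0 else q.1 l) ^ 2 ∂(trainLaw k n F v) = if l ∈ M then 0 else secondMoment F := by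
    intro l
    split_ifs
    · simp
    · unfold trainLaw
      rw [integral_fun_fst (fun β : Fin k → ℝ => β l ^ 2), integral_coef_sq]
      simp
  rw [funext heq]
  refine ⟨h.1, h.2.trans ?_⟩
  simp_rw [hsum, sum_ite_mem]
  ring

lemma sqDeviation_moment [IsProbabilityMeasure F] (hF : MemLp id 2 F) (hM : M.card + 1 < n)
    (i : Fin 2) :
    Integrable (sqDeviation (n := n) v M i) (sampleLaw k n F v) ∧
      ∫ s, sqDeviation (n := n) v M i s ∂(sampleLaw k n F v) =
        (secondMoment F * ((k : ℝ) - M.card) + v) * ((M.card : ℝ) / ((n : ℝ) - M.card - 1)) := by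
  have hg : ∀ l : Fin k, MemLp (fun q : (Fin k → ℝ) × (Fin 2 → Draw k n) =>
      if l ∈ M then betaHat M q.1 (q.2 i) l - q.1 l else 0) 2 (trainLaw k n F v) := by
    intro l
    split_ifs with hl
    · exact (betaHat_dev_train hF hM i hl).1
    · exact memLp_const 0
  have h := integral_query_sq hg 0
  have heq : ∀ s : Sample k n, sqDeviation (n := n) v M i s =
      (s.2.1.1 ⬝ᵥ (fun l => if l ∈ M then betaHat M s.1 (s.2.2 i) l - s.1 l else 0) +
        0 * s.2.1.2) ^ 2 := by
    intro s
    rw [sqDeviation, prediction, ← dotProduct_sub, zero_mul, add_zero, ← neg_sq, ← dotProduct_neg]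
    congr 2
    ext l
    rw [Pi.neg_apply, Pi.sub_apply, meanBetaHat_eq hM]
    split_ifs with hl
    · ring
    · rw [betaHat_of_notMem _ _ hl]; simp
  have hsum : ∀ l : Fin k, ∫ q : (Fin k → ℝ) × (Fin 2 → Draw k n),
      (if l ∈ M then betaHat M q.1 (q.2 i) l - q.1 l else 0) ^ 2 ∂(trainLaw k n F v) =
      if l ∈ M then (secondMoment F * ((k : ℝ) - M.card) + v) * ((n : ℝ) - M.card - 1)⁻¹ else 0 := by
    intro l
    split_ifs with hl
    · exact (betaHat_dev_train hF hM i hl).2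
    · simp
  rw [funext heq]
  refine ⟨h.1, h.2.trans ?_⟩
  simp_rw [hsum, sum_ite_mem]
  ring

lemma sum_residual_sq [IsProbabilityMeasure F] (hF : MemLp id 2 F) (hM : M.card + 1 < n)
    (i : Fin 2) :
    ∑ l, ∫ q, residual M i l q ^ 2 ∂(trainLaw k n F v) + v =
      risk k n (secondMoment F) v M.card := by
  simp_rw [integral_residual_sq hF hM, sum_ite_mem, risk]
  ring

lemma sqError_moment [IsProbabilityMeasure F] (hF : MemLp id 2 F) (hM : M.card + 1 < n)
    (i : Fin 2) :
    Integrable (sqError (n := n) M i) (sampleLaw k n F v) ∧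
      ∫ s, sqError (n := n) M i s ∂(sampleLaw k n F v) =
        risk k n (secondMoment F) v M.card := by
  have h := integral_query_sq (fun l => memLp_residual (v := v) hF hM i l) 1
  have heq : ∀ s : Sample k n, sqError (n := n) M i s =
      (s.2.1.1 ⬝ᵥ (fun l => residual M i l (s.1, s.2.2)) + 1 * s.2.1.2) ^ 2 := by
    intro s
    have : (fun l => residual M i l (s.1, s.2.2)) = s.1 - betaHat M s.1 (s.2.2 i) := rfl
    rw [this, dotProduct_sub, sqError, outcome, prediction]
    ring
  rw [funext heq]
  refine ⟨h.1, h.2.trans ?_⟩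
  rw [← sum_residual_sq hF hM i]
  ring

/-- The mean squared error of a weighted average of two models. -/
lemma integral_weighted_error [IsProbabilityMeasure F] (hF : MemLp id 2 F) (hM : M.card + 1 < n)
    (hM' : M'.card + 1 < n) {a b : ℝ} (hab : a + b = 1) :
    ∫ s : Sample k n, (outcome s - (a * prediction M 0 s + b * prediction M' 1 s)) ^ 2
        ∂(sampleLaw k n F v) =
      a ^ 2 * risk k n (secondMoment F) v M.card + b ^ 2 * risk k n (secondMoment F) v M'.card +
        2 * a * b * (v + secondMoment F * ((k : ℝ) - (M ∪ M').card)) := by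
  have h0 := fun l => memLp_residual (v := v) hF hM 0 l
  have h1 := fun l => memLp_residual (v := v) hF hM' 1 l
  have h := integral_query_sq (g := fun l q => a * residual M 0 l q + b * residual M' 1 l q)
    (fun l => ((h0 l).const_mul a).add ((h1 l).const_mul b)) 1
  have heq : ∀ s : Sample k n, (outcome s - (a * prediction M 0 s + b * prediction M' 1 s)) ^ 2 =
      (s.2.1.1 ⬝ᵥ (fun l => a * residual M 0 l (s.1, s.2.2) + b * residual M' 1 l (s.1, s.2.2)) +
        1 * s.2.1.2) ^ 2 := by
    intro s
    have : (fun l => a * residual M 0 l (s.1, s.2.2) + b * residual M' 1 l (s.1, s.2.2)) =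
      a • (s.1 - betaHat M s.1 (s.2.2 0)) + b • (s.1 - betaHat M' s.1 (s.2.2 1)) := rfl
    rw [this, dotProduct_add, dotProduct_smul, dotProduct_smul, dotProduct_sub, dotProduct_sub,
      outcome, prediction, prediction]
    -- Weights summing to one let the outcome be split in the proportions of the two predictions.
    obtain rfl : b = 1 - a := by linarith
    simp only [smul_eq_mul]
    ring
  have hl : ∀ l : Fin k, ∫ q, (a * residual M 0 l q + b * residual M' 1 l q) ^ 2
      ∂(trainLaw k n F v) = a ^ 2 * ∫ q, residual M 0 l q ^ 2 ∂(trainLaw k n F v) +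
      b ^ 2 * ∫ q, residual M' 1 l q ^ 2 ∂(trainLaw k n F v) +
      2 * a * b * (if l ∈ M ∪ M' then 0 else secondMoment F) := by
    intro l
    rw [← integral_residual_mul (v := v) hF hM hM' l, ← integral_const_mul, ← integral_const_mul,
      ← integral_const_mul, ← integral_add ((h0 l).integrable_sq.const_mul _)
        ((h1 l).integrable_sq.const_mul _)]
    refine Eq.trans ?_ (integral_add (((h0 l).integrable_sq.const_mul _).add
      ((h1 l).integrable_sq.const_mul _)) (((h0 l).integrable_mul (h1 l)).const_mul _))
    refine integral_congr_ae (ae_of_all _ fun q => ?_)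
    beta_reduce
    ring
  simp_rw [heq]
  refine h.2.trans ?_
  simp_rw [hl]
  rw [Finset.sum_add_distrib, Finset.sum_add_distrib, ← Finset.mul_sum, ← Finset.mul_sum,
    ← Finset.mul_sum, sum_ite_mem, ← sum_residual_sq hF hM 0, ← sum_residual_sq hF hM' 1]
  -- The noise variance splits as (a + b)²v among the two risks and the cross term.
  obtain rfl : b = 1 - a := by linarith
  ring

end PartOne

namespace Market

/-! ### The consumer's problem -/

variable {m : Market}

instance (m : Market) : IsProbabilityMeasure m.coefLaw := m.isProb

lemma card_add_one_lt (m : Market) (M : Finset (Fin m.k)) : M.card + 1 < m.n := by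
  have h1 : M.card ≤ m.k := by simpa using M.card_le_univ
  have h2 := m.lt_n
  omega

/-- The mean squared error of a firm's model, as a function of the number of covariates. -/
def modelRisk (m : Market) (d : ℕ) : ℝ := risk m.k m.n (secondMoment m.coefLaw) m.noiseVar d

/-- The expected product of the prediction errors of two firms. -/
def crossRisk (m : Market) (M₀ M₁ : Finset (Fin m.k)) : ℝ :=
  m.noiseVar + secondMoment m.coefLaw * ((m.k : ℝ) - (M₀ ∪ M₁).card)

lemma mse_of_both {a : m.Profile} {M₀ M₁ : Finset (Fin m.k)} (h0 : a 0 = some M₀)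
    (h1 : a 1 = some M₁) {w : Fin 2 → ℝ} (hw : w 0 + w 1 = 1) :
    m.mse a w = w 0 ^ 2 * m.modelRisk M₀.card + w 1 ^ 2 * m.modelRisk M₁.card +
      2 * w 0 * w 1 * m.crossRisk M₀ M₁ := by
  rw [mse, modelRisk, modelRisk, crossRisk, ← integral_weighted_error m.memLp (m.card_add_one_lt M₀)
    (m.card_add_one_lt M₁) hw]
  simp only [Fin.sum_univ_two, h0, h1, actionPrediction]

lemma mse_of_single {a : m.Profile} {M : Finset (Fin m.k)} {i : Fin 2} (hi : a i = some M)
    {w : Fin 2 → ℝ} (hw : w ∈ weights {i}) : m.mse a w = m.modelRisk M.card := by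
  obtain ⟨-, hw0, hw1⟩ := hw
  rw [Finset.sum_singleton] at hw1
  have hsum : ∀ s, ∑ j, w j * m.actionPrediction j (a j) s = prediction M i s := by
    intro s
    rw [Finset.sum_eq_single i, hw1, hi, one_mul, actionPrediction]
    · intro j _ hj
      rw [hw0 j (by simpa using hj), zero_mul]
    · simp
  simp_rw [mse, hsum]
  exact (sqError_moment m.memLp (m.card_add_one_lt M) i).2

lemma single_mem_weights (i : Fin 2) : (Pi.single i 1 : Fin 2 → ℝ) ∈ weights {i} := by
  refine ⟨fun j => ?_, fun j hj => ?_, by simp⟩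
  · by_cases h : j = i
    · subst h; simp
    · simp [Pi.single_eq_of_ne h]
  · exact Pi.single_eq_of_ne (by simpa using hj) _

lemma utility_empty (a : m.Profile) : m.utility a ∅ = m.outside := if_pos rfl

lemma utility_single {a : m.Profile} {M : Finset (Fin m.k)} {i : Fin 2} (hi : a i = some M) :
    m.utility a {i} = -m.modelRisk M.card := by
  rw [utility, if_neg (Finset.singleton_ne_empty i)]
  have : (fun w => -m.mse a w) '' weights {i} = {-m.modelRisk M.card} := by
    ext x
    simp only [Set.mem_image, Set.mem_singleton_iff]
    constructor
    · rintro ⟨w, hw, rfl⟩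
      rw [mse_of_single hi hw]
    · rintro rfl
      exact ⟨_, single_mem_weights i, by rw [mse_of_single hi (single_mem_weights i)]⟩
  rw [this, csSup_singleton]

lemma finset_fin_two (P : Finset (Fin 2)) : P = ∅ ∨ P = {0} ∨ P = {1} ∨ P = Finset.univ := by
  revert P
  decide

lemma mem_entrants {a : m.Profile} {i : Fin 2} : i ∈ m.entrants a ↔ ∃ M, a i = some M := by
  simp [entrants, Option.isSome_iff_exists]

/-- The consumer's payoff attains its optimum over the weights. -/
lemma exists_isGreatest_payoff {a : m.Profile} {P : Finset (Fin 2)} (hP : P ⊆ m.entrants a)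
    (hne : P.Nonempty) : ∃ w ∈ weights P, ∀ w' ∈ weights P, -m.mse a w' ≤ -m.mse a w := by
  have hsing : ∀ i, P = {i} → ∃ w ∈ weights P, ∀ w' ∈ weights P, -m.mse a w' ≤ -m.mse a w := by
    rintro i rfl
    obtain ⟨M, hM⟩ := mem_entrants.1 (hP (Finset.mem_singleton_self i))
    refine ⟨_, single_mem_weights i, fun w' hw' => ?_⟩
    rw [mse_of_single hM hw', mse_of_single hM (single_mem_weights i)]
  rcases finset_fin_two P with rfl | h | h | rfl
  · exact absurd hne Finset.not_nonempty_empty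
  · exact hsing 0 h
  · exact hsing 1 h
  · obtain ⟨M₀, h0⟩ := mem_entrants.1 (hP (Finset.mem_univ 0))
    obtain ⟨M₁, h1⟩ := mem_entrants.1 (hP (Finset.mem_univ 1))
    -- The weights on two firms form a segment, on which the quadratic loss attains its minimum.
    obtain ⟨t, ht, hmax⟩ := (isCompact_Icc (a := (0 : ℝ)) (b := 1)).exists_isMaxOn
      (f := fun t => -(t ^ 2 * m.modelRisk M₀.card + (1 - t) ^ 2 * m.modelRisk M₁.card +
        2 * t * (1 - t) * m.crossRisk M₀ M₁)) ⟨0, by simp⟩ (by fun_prop)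
    refine ⟨![t, 1 - t], ⟨fun i => ?_, fun i hi => absurd (Finset.mem_univ i) hi, by simp⟩,
      fun w' hw' => ?_⟩
    · fin_cases i
      · simpa using ht.1
      · simpa using ht.2
    · obtain ⟨hw0, -, hw1⟩ := hw'
      rw [Fin.sum_univ_two] at hw1
      have h1' : w' 1 = 1 - w' 0 := by linarith
      have := hmax (show w' 0 ∈ Set.Icc (0 : ℝ) 1 from ⟨hw0 0, by linarith [hw0 1]⟩)
      rw [mse_of_both h0 h1 hw1, mse_of_both h0 h1 (by simp), h1']
      simpa using this

lemma exists_utility_eq {a : m.Profile} {P : Finset (Fin 2)} (hP : P ⊆ m.entrants a)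
    (hne : P.Nonempty) : ∃ w ∈ weights P, m.utility a P = -m.mse a w ∧
      ∀ w' ∈ weights P, -m.mse a w' ≤ m.utility a P := by
  obtain ⟨w, hw, hmax⟩ := exists_isGreatest_payoff hP hne
  have h : IsGreatest ((fun w => -m.mse a w) '' weights P) (-m.mse a w) :=
    ⟨⟨w, hw, rfl⟩, by rintro _ ⟨w', hw', rfl⟩; exact hmax w' hw'⟩
  have hu : m.utility a P = -m.mse a w := by
    rw [utility, if_neg hne.ne_empty, h.csSup_eq]
  exact ⟨w, hw, hu, fun w' hw' => hu ▸ hmax w' hw'⟩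

/-- The consumer's payoff from buying from the firms in `P` and weighting them optimally. -/
def value (m : Market) (a : m.Profile) (p : Fin 2 → ℝ) (P : Finset (Fin 2)) : ℝ :=
  m.utility a P - ∑ i ∈ P, p i

lemma consumerPayoff_le_value {a : m.Profile} {z : Purchase} (hz : m.Feasible a z)
    (p : Fin 2 → ℝ) : m.consumerPayoff a p z ≤ m.value a p z.1 := by
  rw [consumerPayoff, value]
  refine sub_le_sub_right ?_ _
  split_ifs with h
  · rw [h, utility_empty]
  · have hne := Finset.nonempty_iff_ne_empty.2 h
    obtain ⟨-, -, -, hle⟩ := exists_utility_eq hz.1 hne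
    exact hle _ (hz.2 hne)

lemma exists_consumerPayoff_eq_value {a : m.Profile} {P : Finset (Fin 2)} (hP : P ⊆ m.entrants a) :
    ∃ w, m.Feasible a (P, w) ∧ ∀ p, m.consumerPayoff a p (P, w) = m.value a p P := by
  rcases P.eq_empty_or_nonempty with rfl | hne
  · exact ⟨0, ⟨hP, fun h => absurd h Finset.not_nonempty_empty⟩, fun p => by
      simp [consumerPayoff, value, utility_empty]⟩
  · obtain ⟨w, hw, hu, -⟩ := exists_utility_eq hP hne
    exact ⟨w, ⟨hP, fun _ => hw⟩, fun p => by rw [consumerPayoff, value, hu, if_neg hne.ne_empty]⟩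

lemma IsSPNE.value_le {S : m.Strategy} (hS : m.IsSPNE S) (a : m.Profile) (p : Fin 2 → ℝ)
    {Q : Finset (Fin 2)} (hQ : Q ⊆ m.entrants a) :
    m.value a p Q ≤ m.value a p (S.buy a p).1 := by
  obtain ⟨w, hw, hp⟩ := exists_consumerPayoff_eq_value hQ
  rw [← hp p]
  exact (hS.consumer a p _ hw).trans (consumerPayoff_le_value (hS.feasible a p) p)

/-! ### Two entrants -/

/-- The profile in which the two firms enter with the given models. -/
def duo (m : Market) (M₀ M₁ : Finset (Fin m.k)) : m.Profile := ![some M₀, some M₁]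

/-- The consumer's payoff, gross of prices, from optimally combining two models. -/
def duoUtility (m : Market) (M₀ M₁ : Finset (Fin m.k)) : ℝ := m.utility (m.duo M₀ M₁) Finset.univ

lemma eq_duo {a : m.Profile} {M₀ M₁ : Finset (Fin m.k)} (h0 : a 0 = some M₀) (h1 : a 1 = some M₁) :
    a = m.duo M₀ M₁ := by
  ext i : 1
  fin_cases i
  · exact h0
  · exact h1

@[simp] lemma entrants_duo (M₀ M₁ : Finset (Fin m.k)) : m.entrants (m.duo M₀ M₁) = Finset.univ := by
  ext i
  fin_cases i <;> simp [mem_entrants, duo]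

lemma utility_duo_zero (M₀ M₁ : Finset (Fin m.k)) :
    m.utility (m.duo M₀ M₁) {0} = -m.modelRisk M₀.card := utility_single rfl

lemma utility_duo_one (M₀ M₁ : Finset (Fin m.k)) :
    m.utility (m.duo M₀ M₁) {1} = -m.modelRisk M₁.card := utility_single rfl

lemma neg_weighted_le_duoUtility (M₀ M₁ : Finset (Fin m.k)) {t : ℝ} (h0 : 0 ≤ t) (h1 : t ≤ 1) :
    -(t ^ 2 * m.modelRisk M₀.card + (1 - t) ^ 2 * m.modelRisk M₁.card +
      2 * t * (1 - t) * m.crossRisk M₀ M₁) ≤ m.duoUtility M₀ M₁ := by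
  obtain ⟨-, -, -, hle⟩ := exists_utility_eq (a := m.duo M₀ M₁) (P := Finset.univ) (by simp) (by simp)
  have hw : ![t, 1 - t] ∈ weights Finset.univ := by
    refine ⟨fun i => ?_, fun i hi => absurd (Finset.mem_univ i) hi, by simp⟩
    fin_cases i
    · simpa using h0
    · simpa using h1
  have := hle _ hw
  rw [mse_of_both (M₀ := M₀) (M₁ := M₁) rfl rfl (by simp)] at this
  simpa [duoUtility] using this

lemma exists_duoUtility_eq (M₀ M₁ : Finset (Fin m.k)) : ∃ t : ℝ, m.duoUtility M₀ M₁ =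
    -(t ^ 2 * m.modelRisk M₀.card + (1 - t) ^ 2 * m.modelRisk M₁.card +
      2 * t * (1 - t) * m.crossRisk M₀ M₁) := by
  obtain ⟨w, ⟨-, -, hw⟩, hu, -⟩ :=
    exists_utility_eq (a := m.duo M₀ M₁) (P := Finset.univ) (by simp) (by simp)
  rw [Fin.sum_univ_two] at hw
  refine ⟨w 0, ?_⟩
  rw [duoUtility, hu, mse_of_both (M₀ := M₀) (M₁ := M₁) rfl rfl hw,
    show w 1 = 1 - w 0 by linarith]

lemma neg_modelRisk_le_duoUtility_left (M₀ M₁ : Finset (Fin m.k)) :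
    -m.modelRisk M₀.card ≤ m.duoUtility M₀ M₁ := by
  simpa using neg_weighted_le_duoUtility M₀ M₁ zero_le_one le_rfl

lemma neg_modelRisk_le_duoUtility_right (M₀ M₁ : Finset (Fin m.k)) :
    -m.modelRisk M₁.card ≤ m.duoUtility M₀ M₁ := by
  simpa using neg_weighted_le_duoUtility M₀ M₁ le_rfl zero_le_one

lemma neg_average_le_duoUtility (M₀ M₁ : Finset (Fin m.k)) :
    -((m.modelRisk M₀.card + m.modelRisk M₁.card) / 4 + m.crossRisk M₀ M₁ / 2) ≤
      m.duoUtility M₀ M₁ := by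
  refine le_trans (le_of_eq ?_) (neg_weighted_le_duoUtility M₀ M₁ (t := 1 / 2) (by norm_num)
    (by norm_num))
  ring

lemma erase_univ_zero : (Finset.univ : Finset (Fin 2)).erase 0 = {1} := by decide
lemma erase_univ_one : (Finset.univ : Finset (Fin 2)).erase 1 = {0} := by decide

/-- This is decreasing returns for firm 0 joining firm 1, compared with firm 0 joining nobody. -/
lemma DecreasingMarginalReturns.duo_le (h : m.DecreasingMarginalReturns)
    (M₀ M₁ : Finset (Fin m.k)) :
    m.duoUtility M₀ M₁ + m.outside ≤ -m.modelRisk M₀.card + -m.modelRisk M₁.card := by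
  have := h (m.duo M₀ M₁) Finset.univ (by simp) {0} (by simp) 0 (by simp)
  rw [erase_univ_zero, utility_duo_one, Finset.erase_singleton, utility_duo_zero,
    utility_empty] at this
  rw [duoUtility]
  linarith

/-- Apply `duo_le` to two copies of the model: the second copy cannot hurt, so the first must be
worth buying. -/
lemma DecreasingMarginalReturns.outside_le (h : m.DecreasingMarginalReturns)
    (M : Finset (Fin m.k)) : m.outside ≤ -m.modelRisk M.card := by
  linarith [h.duo_le M M, neg_modelRisk_le_duoUtility_left M M]

lemma value_empty (a : m.Profile) (p : Fin 2 → ℝ) : m.value a p ∅ = m.outside := by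
  simp [value, utility_empty]

lemma value_duo_zero (M₀ M₁ : Finset (Fin m.k)) (p : Fin 2 → ℝ) :
    m.value (m.duo M₀ M₁) p {0} = -m.modelRisk M₀.card - p 0 := by
  simp [value, utility_duo_zero]

lemma value_duo_one (M₀ M₁ : Finset (Fin m.k)) (p : Fin 2 → ℝ) :
    m.value (m.duo M₀ M₁) p {1} = -m.modelRisk M₁.card - p 1 := by
  simp [value, utility_duo_one]

lemma value_duo_univ (M₀ M₁ : Finset (Fin m.k)) (p : Fin 2 → ℝ) :
    m.value (m.duo M₀ M₁) p Finset.univ = m.duoUtility M₀ M₁ - (p 0 + p 1) := by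
  simp [value, duoUtility]

/-- The first firm sells if its price is below its marginal contribution. -/
lemma IsSPNE.zero_mem_buy {S : m.Strategy} (hS : m.IsSPNE S) (h : m.DecreasingMarginalReturns)
    (M₀ M₁ : Finset (Fin m.k)) {p : Fin 2 → ℝ}
    (hp : p 0 < m.duoUtility M₀ M₁ + m.modelRisk M₁.card) :
    (0 : Fin 2) ∈ (S.buy (m.duo M₀ M₁) p).1 := by
  have h0 := hS.value_le (m.duo M₀ M₁) p (Q := {0}) (by simp)
  have h1 := hS.value_le (m.duo M₀ M₁) p (Q := Finset.univ) (by simp)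
  have hd := h.duo_le M₀ M₁
  rw [value_duo_zero] at h0
  rw [value_duo_univ] at h1
  -- Buying only from firm 1 is beaten by adding firm 0. Buying nothing is beaten by firm 0 alone,
  -- because decreasing returns make its contribution on its own at least as large. The rival's
  -- price plays no role.
  rcases finset_fin_two (S.buy (m.duo M₀ M₁) p).1 with e | e | e | e <;> rw [e] at h0 h1 ⊢
  · rw [value_empty] at h0
    linarith
  · simp
  · rw [value_duo_one] at h1
    linarith
  · simp

/-- Staying out is available, and feasibility then excludes a sale, so the deviation price 0 is
immaterial. -/
lemma IsSPNE.profit_nonneg {S : m.Strategy} (hS : m.IsSPNE S) (i : Fin 2) :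
    0 ≤ m.profit S.buy i S.model (S.price S.model) := by
  have h := hS.entry i none 0
  refine le_trans (le_of_eq ?_) h
  have hi : i ∉ (S.buy (Function.update S.model i none)
      (Function.update (S.price (Function.update S.model i none)) i 0)).1 := by
    intro hi
    obtain ⟨M, hM⟩ := mem_entrants.1 ((hS.feasible _ _).1 hi)
    simp at hM
  rw [profit, if_neg hi]
  simp [actionCost]

/-- In an equilibrium with two entrants, the first firm's profit is at most its marginal
contribution net of its cost. -/
lemma IsSPNE.profit_zero_le {S : m.Strategy} (hS : m.IsSPNE S) {M₀ M₁ : Finset (Fin m.k)}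
    (ha : S.model = m.duo M₀ M₁) :
    m.profit S.buy 0 S.model (S.price S.model) ≤
      m.duoUtility M₀ M₁ + m.modelRisk M₁.card - m.cost M₀.card := by
  -- A firm without a sale would lose its positive entry cost.
  have hmem : ∀ i, i ∈ (S.buy S.model (S.price S.model)).1 := by
    intro i
    by_contra hi
    have hn := hS.profit_nonneg i
    rw [profit, if_neg hi] at hn
    have : 0 < m.actionCost (S.model i) := by
      rw [ha]
      fin_cases i
      · exact m.cost_pos _
      · exact m.cost_pos _
    linarith
  have huniv : (S.buy S.model (S.price S.model)).1 = Finset.univ := by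
    ext i
    simp [hmem i]
  -- The consumer could drop firm 0, which caps its price.
  have h1 := hS.value_le S.model (S.price S.model) (Q := {1}) (by rw [ha]; simp)
  rw [profit, if_pos (hmem 0)]
  rw [huniv] at h1
  generalize S.price S.model = p at h1 ⊢
  rw [ha] at h1 ⊢
  rw [value_duo_one, value_duo_univ] at h1
  change p 0 - m.cost M₀.card ≤ _
  linarith

lemma update_duo_zero (M₀ M₁ M' : Finset (Fin m.k)) :
    Function.update (m.duo M₀ M₁) 0 (some M') = m.duo M' M₁ :=
  eq_duo (by simp) (by simp [duo])

lemma update_duo_one (M₀ M₁ M' : Finset (Fin m.k)) :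
    Function.update (m.duo M₀ M₁) 1 (some M') = m.duo M₀ M' :=
  eq_duo (by simp [duo]) (by simp)

/-- In an equilibrium with two entrants, no other model of the first firm has a higher marginal
contribution net of its cost. -/
lemma IsSPNE.duo_deviation_le {S : m.Strategy} (hS : m.IsSPNE S) (h : m.DecreasingMarginalReturns)
    {M₀ M₁ : Finset (Fin m.k)} (ha : S.model = m.duo M₀ M₁) (M' : Finset (Fin m.k)) :
    m.duoUtility M' M₁ - m.cost M'.card ≤ m.duoUtility M₀ M₁ - m.cost M₀.card := by
  have hle := hS.profit_zero_le ha
  -- Only prices strictly below the new marginal contribution are sure to sell; the bound at the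
  -- contribution itself follows by density.
  have key : ∀ q < m.duoUtility M' M₁ + m.modelRisk M₁.card,
      q ≤ m.duoUtility M₀ M₁ + m.modelRisk M₁.card - m.cost M₀.card + m.cost M'.card := by
    intro q hq
    have he := hS.entry 0 (some M') q
    have hb : (0 : Fin 2) ∈ (S.buy (m.duo M' M₁)
        (Function.update (S.price (m.duo M' M₁)) 0 q)).1 :=
      hS.zero_mem_buy h M' M₁ (by simpa using hq)
    have hup : Function.update S.model 0 (some M') = m.duo M' M₁ := by rw [ha, update_duo_zero]
    rw [hup, profit, if_pos hb, Function.update_self] at he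
    change q - m.cost M'.card ≤ _ at he
    linarith
  linarith [le_of_forall_lt_imp_le_of_dense key]

/-! ### Construction of equilibria -/

/-- The marginal contribution of a firm to the consumer's payoff (`0` if it stays out). -/
def marginal (m : Market) (a : m.Profile) (i : Fin 2) : ℝ :=
  m.utility a (m.entrants a) - m.utility a ((m.entrants a).erase i)

lemma marginal_of_notMem {a : m.Profile} {i : Fin 2} (hi : i ∉ m.entrants a) :
    m.marginal a i = 0 := by
  rw [marginal, Finset.erase_eq_of_notMem hi, sub_self]

lemma marginal_duo_zero (M₀ M₁ : Finset (Fin m.k)) :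
    m.marginal (m.duo M₀ M₁) 0 = m.duoUtility M₀ M₁ + m.modelRisk M₁.card := by
  rw [marginal, entrants_duo, erase_univ_zero, utility_duo_one, duoUtility, sub_neg_eq_add]

lemma marginal_duo_one (M₀ M₁ : Finset (Fin m.k)) :
    m.marginal (m.duo M₀ M₁) 1 = m.duoUtility M₀ M₁ + m.modelRisk M₀.card := by
  rw [marginal, entrants_duo, erase_univ_one, utility_duo_zero, duoUtility, sub_neg_eq_add]

lemma exists_eq_duo {a : m.Profile} (ha : m.entrants a = Finset.univ) :
    ∃ M₀ M₁, a = m.duo M₀ M₁ := by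
  obtain ⟨M₀, h0⟩ := mem_entrants.1 (ha ▸ Finset.mem_univ 0 : (0 : Fin 2) ∈ m.entrants a)
  obtain ⟨M₁, h1⟩ := mem_entrants.1 (ha ▸ Finset.mem_univ 1 : (1 : Fin 2) ∈ m.entrants a)
  exact ⟨M₀, M₁, eq_duo h0 h1⟩

lemma DecreasingMarginalReturns.marginal_nonneg (h : m.DecreasingMarginalReturns) (a : m.Profile)
    (i : Fin 2) : 0 ≤ m.marginal a i := by
  by_cases hi : i ∈ m.entrants a
  swap
  · rw [marginal_of_notMem hi]
  have hsing : m.entrants a = {i} → 0 ≤ m.marginal a i := by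
    intro he
    obtain ⟨M, hM⟩ := mem_entrants.1 hi
    rw [marginal, he, Finset.erase_singleton, utility_single hM, utility_empty]
    linarith [h.outside_le M]
  rcases finset_fin_two (m.entrants a) with e | e | e | e
  · rw [e] at hi
    exact absurd hi (Finset.notMem_empty i)
  · rw [e, Finset.mem_singleton] at hi
    subst hi
    exact hsing e
  · rw [e, Finset.mem_singleton] at hi
    subst hi
    exact hsing e
  · obtain ⟨M₀, M₁, rfl⟩ := exists_eq_duo e
    fin_cases i
    · change 0 ≤ m.marginal _ 0
      rw [marginal_duo_zero]
      linarith [neg_modelRisk_le_duoUtility_right M₀ M₁]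
    · change 0 ≤ m.marginal _ 1
      rw [marginal_duo_one]
      linarith [neg_modelRisk_le_duoUtility_left M₀ M₁]

/-- At prices equal to the marginal contributions, buying from all entrants is optimal. -/
lemma DecreasingMarginalReturns.value_marginal_le (h : m.DecreasingMarginalReturns)
    (a : m.Profile) {P : Finset (Fin 2)} (hP : P ⊆ m.entrants a) :
    m.value a (m.marginal a) P ≤ m.value a (m.marginal a) (m.entrants a) := by
  have hsing : ∀ i, m.entrants a = {i} →
      m.value a (m.marginal a) P ≤ m.value a (m.marginal a) (m.entrants a) := by
    intro i he
    rw [he] at hP ⊢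
    rcases Finset.subset_singleton_iff.1 hP with rfl | rfl
    · rw [value_empty, value, Finset.sum_singleton, marginal, he, Finset.erase_singleton,
        utility_empty]
      linarith
    · exact le_rfl
  rcases finset_fin_two (m.entrants a) with e | e | e | e
  · rw [e, Finset.subset_empty] at hP
    rw [e, hP]
  · exact hsing 0 e
  · exact hsing 1 e
  · obtain ⟨M₀, M₁, rfl⟩ := exists_eq_duo e
    have hd := h.duo_le M₀ M₁
    rw [entrants_duo, value_duo_univ, marginal_duo_zero, marginal_duo_one]
    rcases finset_fin_two P with rfl | rfl | rfl | rfl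
    · rw [value_empty]
      linarith
    · rw [value_duo_zero, marginal_duo_zero]
      linarith
    · rw [value_duo_one, marginal_duo_one]
      linarith
    · rw [value_duo_univ, marginal_duo_zero, marginal_duo_one]

/-- A firm sells, while its rival asks for its marginal contribution, only if its own price is at
most its marginal contribution. -/
lemma DecreasingMarginalReturns.price_le_marginal (h : m.DecreasingMarginalReturns)
    {a : m.Profile} {i : Fin 2} {q : ℝ} {P : Finset (Fin 2)} (hP : P ⊆ m.entrants a) (hi : i ∈ P)
    (hopt : ∀ Q ⊆ m.entrants a, m.value a (Function.update (m.marginal a) i q) Q ≤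
      m.value a (Function.update (m.marginal a) i q) P) : q ≤ m.marginal a i := by
  have h1 : m.value a (Function.update (m.marginal a) i q) P =
      m.value a (m.marginal a) P - (q - m.marginal a i) := by
    rw [value, value, Finset.sum_update_of_mem hi, ← Finset.add_sum_erase P _ hi,
      Finset.sdiff_singleton_eq_erase]
    ring
  -- At the marginal price the consumer is indifferent to firm i, so dropping it preserves the
  -- optimal value and defeats any higher price.
  have h2 : m.value a (Function.update (m.marginal a) i q) ((m.entrants a).erase i) =
      m.value a (m.marginal a) (m.entrants a) := by
    rw [value, value, ← Finset.add_sum_erase (m.entrants a) _ (hP hi),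
      Finset.sum_update_of_notMem (Finset.notMem_erase i _), marginal]
    ring
  have h3 := hopt _ (Finset.erase_subset i (m.entrants a))
  have h4 := h.value_marginal_le a hP
  rw [h1, h2] at h3
  linarith

/-- An optimal set of firms, equal to the set of all entrants if that is optimal. -/
lemma exists_optimal_set (a : m.Profile) (p : Fin 2 → ℝ) :
    ∃ P ⊆ m.entrants a, (∀ Q ⊆ m.entrants a, m.value a p Q ≤ m.value a p P) ∧
      ((∀ Q ⊆ m.entrants a, m.value a p Q ≤ m.value a p (m.entrants a)) → P = m.entrants a) := by
  by_cases h : ∀ Q ⊆ m.entrants a, m.value a p Q ≤ m.value a p (m.entrants a)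
  · exact ⟨_, Finset.Subset.refl _, h, fun _ => rfl⟩
  · obtain ⟨P, hP, hmax⟩ := Finset.exists_max_image (m.entrants a).powerset (m.value a p)
      ⟨∅, Finset.empty_mem_powerset _⟩
    exact ⟨P, Finset.mem_powerset.1 hP, fun Q hQ => hmax Q (Finset.mem_powerset.2 hQ),
      fun h' => absurd h' h⟩

/-- A Nash equilibrium of the entry game in which each firm earns its marginal contribution net of
its cost extends to a subgame perfect equilibrium. -/
lemma DecreasingMarginalReturns.exists_isSPNE (h : m.DecreasingMarginalReturns) {a : m.Profile}
    (ha : ∀ i b, m.marginal (Function.update a i b) i - m.actionCost b ≤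
      m.marginal a i - m.actionCost (a i)) : ∃ S : m.Strategy, m.IsSPNE S ∧ S.model = a := by
  choose P hP hopt htie using fun (a : m.Profile) (p : Fin 2 → ℝ) => exists_optimal_set a p
  choose w hw hval using fun (a : m.Profile) (p : Fin 2 → ℝ) =>
    exists_consumerPayoff_eq_value (hP a p)
  set S : m.Strategy := ⟨a, m.marginal, fun a p => (P a p, w a p)⟩ with hS
  have hprofit : ∀ a i, m.profit S.buy i a (S.price a) = m.marginal a i - m.actionCost (a i) := by
    intro a i
    -- Ties are broken in favour of all entrants; without this, firms need not sell at their
    -- marginal contributions.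
    have hE : P a (m.marginal a) = m.entrants a :=
      htie a _ fun Q hQ => h.value_marginal_le a hQ
    rw [profit]
    congr 1
    change (if i ∈ P a (m.marginal a) then m.marginal a i else 0) = _
    rw [hE]
    split_ifs with hi
    · rfl
    · rw [marginal_of_notMem hi]
  have hpricing : ∀ a i q, m.profit S.buy i a (Function.update (S.price a) i q) ≤
      m.profit S.buy i a (S.price a) := by
    intro a i q
    rw [hprofit, profit]
    refine sub_le_sub_right ?_ _
    change (if i ∈ P a (Function.update (m.marginal a) i q) then
      (Function.update (m.marginal a) i q) i else 0) ≤ _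
    split_ifs with hi
    · rw [Function.update_self]
      exact h.price_le_marginal (hP a _) hi (hopt a _)
    · exact h.marginal_nonneg a i
  refine ⟨S, ⟨fun a p => hw a p, fun a p z hz => ?_, hpricing, fun i b q => ?_⟩, rfl⟩
  · exact (consumerPayoff_le_value hz p).trans ((hopt a p _ hz.1).trans (hval a p p).ge)
  -- A joint deviation in model and price is dominated by the same model at its marginal
  -- contribution.
  · refine (hpricing _ i q).trans ?_
    rw [hprofit, hprofit]
    simpa using ha i b

end Market

namespace Market

variable {m : Market}

/-! ### Comparing models -/

lemma secondMoment_nonneg (F : Measure ℝ) : 0 ≤ secondMoment F :=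
  integral_nonneg fun _ => sq_nonneg _

lemma crossRisk_self (M : Finset (Fin m.k)) :
    m.crossRisk M M = m.noiseVar + secondMoment m.coefLaw * ((m.k : ℝ) - M.card) := by
  rw [crossRisk, Finset.union_self]

lemma card_le (M : Finset (Fin m.k)) : M.card ≤ m.k := by simpa using M.card_le_univ

lemma crossRisk_self_nonneg (M : Finset (Fin m.k)) : 0 ≤ m.crossRisk M M := by
  rw [crossRisk_self]
  have h1 : (M.card : ℝ) ≤ m.k := by exact_mod_cast card_le M
  have h2 := secondMoment_nonneg m.coefLaw
  have h3 : 0 ≤ secondMoment m.coefLaw * ((m.k : ℝ) - M.card) := mul_nonneg h2 (by linarith)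
  have h4 : (0 : ℝ) ≤ m.noiseVar := m.noiseVar.2
  linarith

lemma modelRisk_eq (M : Finset (Fin m.k)) :
    m.modelRisk M.card = m.crossRisk M M +
      m.crossRisk M M * ((M.card : ℝ) / ((m.n : ℝ) - M.card - 1)) := by
  rw [modelRisk, risk, crossRisk_self]
  ring

lemma denom_pos (M : Finset (Fin m.k)) : 0 < (m.n : ℝ) - M.card - 1 := by
  have : (M.card : ℝ) + 1 < m.n := by exact_mod_cast m.card_add_one_lt M
  linarith

lemma variance_nonneg (M : Finset (Fin m.k)) :
    0 ≤ m.crossRisk M M * ((M.card : ℝ) / ((m.n : ℝ) - M.card - 1)) :=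
  mul_nonneg (crossRisk_self_nonneg M) (div_nonneg (Nat.cast_nonneg _) (denom_pos M).le)

/-- With risk C + V, where C is the common cross risk, weights t and 1 − t give loss C + (t² + (1 −
t)²)V, least at t = 1/2: averaging halves the variance and leaves the rest. -/
lemma duoUtility_self (M : Finset (Fin m.k)) :
    m.duoUtility M M = -((m.modelRisk M.card + m.crossRisk M M) / 2) := by
  refine le_antisymm ?_ ?_
  · obtain ⟨t, ht⟩ := exists_duoUtility_eq M M
    rw [ht, modelRisk_eq]
    nlinarith [mul_nonneg (variance_nonneg M) (sq_nonneg (2 * t - 1))]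
  · refine le_trans (le_of_eq ?_) (neg_average_le_duoUtility M M)
    ring

/-- If both firms use the same covariates, each earns at most half of the variance of the model. -/
lemma IsSPNE.cost_le_variance {S : m.Strategy} (hS : m.IsSPNE S) {M : Finset (Fin m.k)}
    (ha : S.model = m.duo M M) :
    m.cost M.card ≤ m.crossRisk M M * ((M.card : ℝ) / ((m.n : ℝ) - M.card - 1)) / 2 := by
  have h1 := hS.profit_nonneg 0
  have h2 := hS.profit_zero_le ha
  rw [duoUtility_self, modelRisk_eq] at h2
  linarith

/-! ### Costly covariates -/

lemma add_mul_le_of_convex {c : ℕ → ℝ} (hc : ∀ d, c (d + 1) - c d ≤ c (d + 2) - c (d + 1)) (d : ℕ) :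
    c 0 + d * (c 1 - c 0) ≤ c d := by
  have hstep : ∀ d, c 1 - c 0 ≤ c (d + 1) - c d := by
    intro d
    induction d with
    | zero => exact le_rfl
    | succ d ih => exact ih.trans (hc d)
  induction d with
  | zero => simp
  | succ d ih =>
    have := hstep d
    push_cast
    linarith

lemma not_same_model_of_costly {c : ℕ → ℝ} {u : ℝ} (hc : StrictMono c)
    (hconv : ∀ d, c (d + 1) - c d ≤ c (d + 2) - c (d + 1)) :
    ∃ K : ℕ, ∀ m : Market, m.cost = c → m.outside = u → K ≤ m.k →
      m.DecreasingMarginalReturns → ∀ S : m.Strategy, m.IsSPNE S →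
        ¬ ∃ M : Finset (Fin m.k), S.model 0 = some M ∧ S.model 1 = some M := by
  -- Bound on the number of covariates: V ≤ −u since the model beats the outside option, and costs
  -- grow at least with slope c 1 − c 0.
  set D : ℝ := -u / (c 1 - c 0) with hD
  -- Chosen so that k − D ≥ −uD/c(0), which forces V < c(0) once |M| ≤ D. The signs of u and c(0)
  -- come from the market itself.
  refine ⟨⌈D + -u * D / c 0⌉₊, ?_⟩
  rintro m rfl rfl hK hdmr S hS ⟨M, h0, h1⟩
  have hcost := hS.cost_le_variance (eq_duo h0 h1)
  have hs : 0 < m.cost 1 - m.cost 0 := sub_pos.2 (hc zero_lt_one)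
  have hc0 := m.cost_pos 0
  have hu := m.outside_neg
  have hV := variance_nonneg M
  have hC := crossRisk_self_nonneg M
  have hlin := add_mul_le_of_convex hconv M.card
  have hout := hdmr.outside_le M
  rw [modelRisk_eq] at hout
  have hden := denom_pos M
  have hdD : (M.card : ℝ) ≤ D := by
    rw [hD, le_div_iff₀ hs]
    linarith
  have hk : D + -m.outside * D / m.cost 0 ≤ m.k := Nat.ceil_le.1 hK
  have hn : (m.k : ℝ) + 1 < m.n := by exact_mod_cast m.lt_n
  have hden' : -m.outside * D / m.cost 0 < (m.n : ℝ) - M.card - 1 := by linarith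
  rw [div_lt_iff₀ hc0] at hden'
  have hd0 : (0 : ℝ) ≤ M.card := Nat.cast_nonneg _
  have hcd : m.cost 0 ≤ m.crossRisk M M * ((M.card : ℝ) / ((m.n : ℝ) - M.card - 1)) := by
    have : 0 ≤ (M.card : ℝ) * (m.cost 1 - m.cost 0) := mul_nonneg hd0 hs.le
    linarith
  rw [← mul_div_assoc, le_div_iff₀ hden] at hcd
  have hCd : m.crossRisk M M * (M.card : ℝ) ≤ -m.outside * D :=
    mul_le_mul (by linarith) hdD hd0 (by linarith)
  linarith

/-! ### Costless covariates -/

/-- A firm that uses the same covariates as its rival can make itself more useful to the consumer. -/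
lemma exists_duoUtility_gt (hB : 0 < secondMoment m.coefLaw)
    (hv : secondMoment m.coefLaw * ((m.n : ℝ) - 1 - m.k) < m.noiseVar)
    {M : Finset (Fin m.k)} (hM : M.Nonempty) :
    ∃ M', m.duoUtility M M < m.duoUtility M' M := by
  obtain ⟨x, hx⟩ := hM
  have hpos : 0 < M.card := Finset.card_pos.2 ⟨x, hx⟩
  by_cases huniv : M = Finset.univ
  -- From the full model, drop a covariate: the union and hence the cross risk stay the same, while
  -- the own risk falls.
  · refine ⟨M.erase x, lt_of_lt_of_le ?_ (neg_average_le_duoUtility _ _)⟩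
    have hunion : M.erase x ∪ M = M := Finset.union_eq_right.2 (Finset.erase_subset x M)
    have hcross : m.crossRisk (M.erase x) M = m.crossRisk M M := by
      rw [crossRisk, crossRisk, hunion, Finset.union_self]
    have hcard : M.card = m.k := by rw [huniv]; simp
    have hcard' : ((M.erase x).card : ℝ) = m.k - 1 := by
      rw [Finset.card_erase_of_mem hx, hcard, Nat.cast_sub (by omega)]
      simp
    have hrisk : m.modelRisk (M.erase x).card < m.modelRisk M.card := by
      rw [modelRisk_eq, modelRisk_eq, crossRisk_self, crossRisk_self, hcard', hcard]
      have hn : (m.k : ℝ) + 1 < m.n := by exact_mod_cast m.lt_n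
      -- With e = n − k − 1 the two risks are (v + B)(k + e)/(e + 1) and v(k + e)/e, so the
      -- comparison is exactly Be < v.
      obtain ⟨e, he⟩ : ∃ e : ℝ, (m.n : ℝ) = m.k + 1 + e := ⟨m.n - m.k - 1, by ring⟩
      have he0 : 0 < e := by linarith
      rw [he] at hv ⊢
      rw [show (m.k : ℝ) + 1 + e - (m.k - 1) - 1 = e + 1 by ring,
        show (m.k : ℝ) + 1 + e - m.k - 1 = e by ring,
        show (m.k : ℝ) + 1 + e - 1 - m.k = e by ring] at *
      set B := secondMoment m.coefLaw
      set v : ℝ := (m.noiseVar : ℝ)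
      have e1 : v + B * ((m.k : ℝ) - (m.k - 1)) + (v + B * ((m.k : ℝ) - (m.k - 1))) *
          (((m.k : ℝ) - 1) / (e + 1)) = (v + B) * (m.k + e) / (e + 1) := by
        field_simp
        ring
      have e2 : v + B * ((m.k : ℝ) - m.k) + (v + B * ((m.k : ℝ) - m.k)) * ((m.k : ℝ) / e) =
          v * (m.k + e) / e := by
        field_simp
        ring
      rw [e1, e2, div_lt_div_iff₀ (by linarith) he0]
      nlinarith [mul_pos (sub_pos.2 hv) (show (0 : ℝ) < m.k + e by linarith)]
    rw [duoUtility_self, hcross]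
    linarith
  · obtain ⟨y, hy⟩ : ∃ y, y ∉ M := by
      by_contra hcon
      push Not at hcon
      exact huniv (Finset.eq_univ_iff_forall.2 hcon)
    -- Swap a covariate for a new one: the own risk is unchanged, and the union grows by one,
    -- lowering the cross risk.
    refine ⟨insert y (M.erase x), lt_of_lt_of_le ?_ (neg_average_le_duoUtility _ _)⟩
    have hunion : insert y (M.erase x) ∪ M = insert y M := by
      rw [Finset.insert_union, Finset.union_eq_right.2 (Finset.erase_subset x M)]
    have hcard : (insert y (M.erase x)).card = M.card := by
      rw [Finset.card_insert_of_notMem (fun h => hy (Finset.mem_of_mem_erase h)),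
        Finset.card_erase_of_mem hx]
      omega
    have hcross : m.crossRisk (insert y (M.erase x)) M =
        m.crossRisk M M - secondMoment m.coefLaw := by
      rw [crossRisk_self, crossRisk, hunion, Finset.card_insert_of_notMem hy]
      push_cast
      ring
    rw [duoUtility_self, hcross, hcard]
    linarith

lemma IsSPNE.not_same_model_of_costless {S : m.Strategy} (hS : m.IsSPNE S) {c : ℝ}
    (hc : m.cost = fun _ => c) (h : m.DecreasingMarginalReturns)
    (hB : 0 < secondMoment m.coefLaw)
    (hv : secondMoment m.coefLaw * ((m.n : ℝ) - 1 - m.k) < m.noiseVar) :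
    ¬ ∃ M : Finset (Fin m.k), S.model 0 = some M ∧ S.model 1 = some M := by
  rintro ⟨M, h0, h1⟩
  have ha := eq_duo h0 h1
  rcases M.eq_empty_or_nonempty with rfl | hM
  · have h2 := hS.cost_le_variance ha
    have h3 := m.cost_pos (∅ : Finset (Fin m.k)).card
    simp at h2 h3
    linarith
  · obtain ⟨M', hM'⟩ := exists_duoUtility_gt hB hv hM
    have := hS.duo_deviation_le h ha M'
    rw [hc] at this
    linarith

/-- Using d covariates removes bias Bd but adds variance (v + B(k − d))d/(n − d − 1). The variance
is at least Bd because v ≥ B(n − 1 − k), a condition in which d cancels. -/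
lemma modelRisk_empty_le (hv : secondMoment m.coefLaw * ((m.n : ℝ) - 1 - m.k) < m.noiseVar)
    (M : Finset (Fin m.k)) :
    m.noiseVar + secondMoment m.coefLaw * m.k ≤ m.modelRisk M.card := by
  have hden := denom_pos M
  have hd0 : (0 : ℝ) ≤ M.card := Nat.cast_nonneg _
  have h : secondMoment m.coefLaw * M.card ≤
      m.crossRisk M M * ((M.card : ℝ) / ((m.n : ℝ) - M.card - 1)) := by
    rw [← mul_div_assoc, le_div_iff₀ hden, mul_right_comm]
    refine mul_le_mul_of_nonneg_right ?_ hd0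
    rw [crossRisk_self]
    linarith
  rw [modelRisk_eq]
  have := crossRisk_self M
  linarith

/-- Two disjoint models with a quarter of the covariates each do much better than no covariates. -/
lemma exists_duoUtility_ge (hB : 0 < secondMoment m.coefLaw) (hk : 8 ≤ m.k)
    (hv : m.noiseVar + secondMoment m.coefLaw * m.k ≤
      secondMoment m.coefLaw * (5 / 2 * m.n - 3 / 8 * m.k - 5 / 2)) :
    ∃ M₀ M₁ : Finset (Fin m.k),
      -(m.noiseVar + secondMoment m.coefLaw * m.k) + secondMoment m.coefLaw * m.k / 32 ≤
        m.duoUtility M₀ M₁ := by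
  obtain ⟨M₀, -, hM₀⟩ := Finset.exists_subset_card_eq
    (s := (Finset.univ : Finset (Fin m.k))) (n := m.k / 4) (by simp; omega)
  obtain ⟨M₁, hsub, hM₁⟩ := Finset.exists_subset_card_eq (s := M₀ᶜ) (n := m.k / 4)
    (by rw [Finset.card_compl, hM₀, Fintype.card_fin]; omega)
  refine ⟨M₀, M₁, le_trans ?_ (neg_average_le_duoUtility M₀ M₁)⟩
  have hdisj : Disjoint M₀ M₁ := by
    rw [Finset.disjoint_left]
    intro x hx hx'
    exact Finset.mem_compl.1 (hsub hx') hx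
  have hden := denom_pos M₀
  have hcross : m.crossRisk M₀ M₁ = m.noiseVar +
      secondMoment m.coefLaw * ((m.k : ℝ) - 2 * M₀.card) := by
    rw [crossRisk, Finset.card_union_of_disjoint hdisj, hM₀, hM₁]
    push_cast
    ring
  have hd1 : (4 : ℝ) * M₀.card ≤ m.k := by
    rw [hM₀]
    exact_mod_cast (by omega : 4 * (m.k / 4) ≤ m.k)
  have hd2 : (m.k : ℝ) ≤ 8 * M₀.card := by
    rw [hM₀]
    exact_mod_cast (by omega : m.k ≤ 8 * (m.k / 4))
  -- With d covariates each, disjointness gains 3Bd/2 and variance costs V/2 ≤ 5Bd/4. The net gain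
  -- is at least Bd/4 ≥ Bk/32, as d ≥ k/8; the 3/8 in the hypothesis is 3/2 times d ≤ k/4.
  have hV : m.crossRisk M₀ M₀ * ((M₀.card : ℝ) / ((m.n : ℝ) - M₀.card - 1)) ≤
      5 / 2 * secondMoment m.coefLaw * M₀.card := by
    rw [← mul_div_assoc, div_le_iff₀ hden, mul_right_comm]
    refine mul_le_mul_of_nonneg_right ?_ (Nat.cast_nonneg _)
    rw [crossRisk_self]
    nlinarith
  rw [hM₁, ← hM₀, modelRisk_eq, hcross]
  have hself := crossRisk_self M₀
  nlinarith

lemma DecreasingMarginalReturns.exists_isSPNE_duo (h : m.DecreasingMarginalReturns) {c : ℝ}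
    (hc : m.cost = fun _ => c) (hB : 0 < secondMoment m.coefLaw) (hk : 8 ≤ m.k)
    (hv : secondMoment m.coefLaw * ((m.n : ℝ) - 1 - m.k) < m.noiseVar)
    (hv' : m.noiseVar + secondMoment m.coefLaw * m.k ≤
      secondMoment m.coefLaw * (5 / 2 * m.n - 3 / 8 * m.k - 5 / 2))
    (hcost : c < 1 / 32 * (secondMoment m.coefLaw * m.k)) :
    ∃ (S : m.Strategy) (M₁ M₂ : Finset (Fin m.k)), m.IsSPNE S ∧
      S.model 0 = some M₁ ∧ S.model 1 = some M₂ ∧ M₁ ≠ M₂ := by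
  -- A firm's marginal contribution is the payoff of the pair plus the rival's risk, which it does
  -- not control. Maximizing the former therefore rules out all changes of model.
  obtain ⟨⟨M₀, M₁⟩, -, hmax⟩ := Finset.exists_max_image
    (Finset.univ : Finset (Finset (Fin m.k) × Finset (Fin m.k)))
    (fun q => m.duoUtility q.1 q.2) ⟨(∅, ∅), Finset.mem_univ _⟩
  have hmax' : ∀ N₀ N₁, m.duoUtility N₀ N₁ ≤ m.duoUtility M₀ M₁ :=
    fun N₀ N₁ => hmax (N₀, N₁) (Finset.mem_univ _)
  obtain ⟨Q₀, Q₁, hQ⟩ := exists_duoUtility_ge hB hk hv'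
  have hbig : ∀ M : Finset (Fin m.k), c < m.duoUtility M₀ M₁ + m.modelRisk M.card := by
    intro M
    have h1 := modelRisk_empty_le hv M
    have h2 := hmax' Q₀ Q₁
    linarith
  have hac : ∀ M, m.actionCost (some M) = c := fun M => by rw [actionCost, hc]
  obtain ⟨S, hS, hmodel⟩ := h.exists_isSPNE (a := m.duo M₀ M₁) (by
    intro i b
    fin_cases i
    · change m.marginal (Function.update (m.duo M₀ M₁) 0 b) 0 - _ ≤
        m.marginal (m.duo M₀ M₁) 0 - m.actionCost (some M₀)
      rw [marginal_duo_zero, hac]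
      cases b with
      | none =>
        rw [marginal_of_notMem (by simp [mem_entrants])]
        simp only [actionCost]
        linarith [hbig M₁]
      | some M' =>
        rw [update_duo_zero, marginal_duo_zero, hac]
        linarith [hmax' M' M₁]
    · change m.marginal (Function.update (m.duo M₀ M₁) 1 b) 1 - _ ≤
        m.marginal (m.duo M₀ M₁) 1 - m.actionCost (some M₁)
      rw [marginal_duo_one, hac]
      cases b with
      | none =>
        rw [marginal_of_notMem (by simp [mem_entrants])]
        simp only [actionCost]
        linarith [hbig M₀]
      | some M' =>
        rw [update_duo_one, marginal_duo_one, hac]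
        linarith [hmax' M₀ M'])
  have h0 : S.model 0 = some M₀ := by rw [hmodel]; rfl
  have h1 : S.model 1 = some M₁ := by rw [hmodel]; rfl
  refine ⟨S, M₀, M₁, hS, h0, h1, ?_⟩
  rintro rfl
  exact hS.not_same_model_of_costless hc h hB hv ⟨M₀, h0, h1⟩

/-- In the limit regime the two inequalities that drive the costless case hold. -/
lemma costless_regime {ν ρ δ : ℝ} (hν : 1 ≤ ν) (hρ : ρ < 2 * ν - 1) (hδ : δ ≤ 1 / 50)
    (hδ' : δ ≤ (ρ - ν + 1) / 2) (hB : 0 < secondMoment m.coefLaw) (hk : 100 ≤ m.k)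
    (hn : |(m.n : ℝ) / m.k - ν| < δ)
    (hr : |(m.noiseVar : ℝ) / (secondMoment m.coefLaw * m.k) - ρ| < δ) :
    secondMoment m.coefLaw * ((m.n : ℝ) - 1 - m.k) < m.noiseVar ∧
      m.noiseVar + secondMoment m.coefLaw * m.k ≤
        secondMoment m.coefLaw * (5 / 2 * m.n - 3 / 8 * m.k - 5 / 2) := by
  have hk' : (100 : ℝ) ≤ m.k := by exact_mod_cast hk
  have hk0 : (0 : ℝ) < m.k := by linarith
  obtain ⟨N, hN⟩ : ∃ N : ℝ, N = (m.n : ℝ) / m.k := ⟨_, rfl⟩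
  obtain ⟨r, hrr⟩ : ∃ r : ℝ, r = (m.noiseVar : ℝ) / (secondMoment m.coefLaw * m.k) := ⟨_, rfl⟩
  rw [← hN, abs_lt] at hn
  rw [← hrr, abs_lt] at hr
  have hN' : (m.n : ℝ) = N * m.k := by rw [hN]; field_simp
  have hr' : (m.noiseVar : ℝ) = secondMoment m.coefLaw * (r * m.k) := by rw [hrr]; field_simp
  rw [hN', hr', ← mul_add]
  constructor
  · refine mul_lt_mul_of_pos_left ?_ hB
    -- This is n/k − 1 < ν − 1 + δ ≤ ρ − δ, by the second bound on δ.
    nlinarith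
  · refine mul_le_mul_of_nonneg_left ?_ hB.le
    -- By ρ < 2ν − 1 it suffices that 3/8 + 7δ/2 + 5/(2k) ≤ ν/2; the left side is at most 0.47 for δ
    -- ≤ 1/50 and k ≥ 100.
    nlinarith

end Market

end OLSMarket

end

/-! ### The three claims together. -/

theorem mainTheorem6 :
    -- bias, variance and prediction error of OLS on the covariates in `M`
    (∀ (k n : ℕ) (F : Measure ℝ) (v : ℝ≥0) (M : Finset (Fin k)) (i : Fin 2),
      IsProbabilityMeasure F → MemLp id 2 F → M.card + 1 < n →
      (∀ (β : Fin k → ℝ) (l : Fin k),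
        Integrable (fun D => OLSMarket.betaHat M β D l) (OLSMarket.drawLaw k n v)) ∧
      (Integrable (OLSMarket.sqBias (n := n) v M) (OLSMarket.sampleLaw k n F v) ∧
        ∫ s, OLSMarket.sqBias (n := n) v M s ∂(OLSMarket.sampleLaw k n F v) =
          OLSMarket.secondMoment F * ((k : ℝ) - M.card)) ∧
      (Integrable (OLSMarket.sqDeviation (n := n) v M i) (OLSMarket.sampleLaw k n F v) ∧
        ∫ s, OLSMarket.sqDeviation (n := n) v M i s ∂(OLSMarket.sampleLaw k n F v) =
          (OLSMarket.secondMoment F * ((k : ℝ) - M.card) + v) *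
            ((M.card : ℝ) / ((n : ℝ) - M.card - 1))) ∧
      (Integrable (OLSMarket.sqError (n := n) M i) (OLSMarket.sampleLaw k n F v) ∧
        ∫ s, OLSMarket.sqError (n := n) M i s ∂(OLSMarket.sampleLaw k n F v) =
          v + OLSMarket.secondMoment F * ((k : ℝ) - M.card) +
            (OLSMarket.secondMoment F * ((k : ℝ) - M.card) + v) *
              ((M.card : ℝ) / ((n : ℝ) - M.card - 1)))) ∧
    -- costly covariates
    (∀ (c : ℕ → ℝ) (u : ℝ), StrictMono c → (∀ d, c (d + 1) - c d ≤ c (d + 2) - c (d + 1)) →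
      ∃ K : ℕ, ∀ m : OLSMarket.Market, m.cost = c → m.outside = u → K ≤ m.k →
        m.DecreasingMarginalReturns →
        ∀ S : m.Strategy, m.IsSPNE S →
          ¬ ∃ M : Finset (Fin m.k), S.model 0 = some M ∧ S.model 1 = some M) ∧
    -- costless covariates
    (∀ ν ρ : ℝ, 1 ≤ ν → (ν - 1) * (2 * ν - 1) / ν < ρ → ρ < 2 * ν - 1 →
      ∃ δ > 0, ∃ γ > 0, ∃ K : ℕ, ∀ (m : OLSMarket.Market) (c : ℝ), m.cost = (fun _ => c) →
        K ≤ m.k → |(m.n : ℝ) / m.k - ν| < δ →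
        0 < OLSMarket.secondMoment m.coefLaw →
        |(m.noiseVar : ℝ) / (OLSMarket.secondMoment m.coefLaw * m.k) - ρ| < δ →
        m.DecreasingMarginalReturns →
        (∀ S : m.Strategy, m.IsSPNE S →
          ¬ ∃ M : Finset (Fin m.k), S.model 0 = some M ∧ S.model 1 = some M) ∧
        (c < γ * (OLSMarket.secondMoment m.coefLaw * m.k) →
          ∃ (S : m.Strategy) (M₁ M₂ : Finset (Fin m.k)), m.IsSPNE S ∧
            S.model 0 = some M₁ ∧ S.model 1 = some M₂ ∧ M₁ ≠ M₂)) := by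
  refine ⟨?_, ?_, ?_⟩
  · intro k n F v M i hF hF2 hM
    exact ⟨fun β l => (OLSMarket.memLp_betaHat hM β l).integrable (by norm_num),
      OLSMarket.sqBias_moment hF2 hM, OLSMarket.sqDeviation_moment hF2 hM i,
      OLSMarket.sqError_moment hF2 hM i⟩
  · intro c u hc hconv
    exact OLSMarket.Market.not_same_model_of_costly hc hconv
  · intro ν ρ hν hρ hρ'
    -- Since 2ν − 1 ≥ ν, the lower threshold for ρ is at least ν − 1, and this keeps δ positive.
    have hlow : ν - 1 < ρ := by
      refine lt_of_le_of_lt ?_ hρ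
      rw [le_div_iff₀ (by linarith)]
      nlinarith
    refine ⟨min (1 / 50) ((ρ - ν + 1) / 2), lt_min (by norm_num) (by linarith), 1 / 32,
      by norm_num, 100, ?_⟩
    intro m c hc hk hn hB hr hdmr
    obtain ⟨h1, h2⟩ := OLSMarket.Market.costless_regime hν hρ' (min_le_left _ _)
      (min_le_right _ _) hB hk hn hr
    exact ⟨fun S hS => hS.not_same_model_of_costless hc hdmr hB h1,
      fun hcost => hdmr.exists_isSPNE_duo hc hB (by omega) h1 h2 hcost⟩
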